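/- A grammar $G=\langle\Xi,\mathcal A,\Delta\rangle$ consists of finite disjoint sets $\Xi$ (nonterminals) and $\mathcal A$ (terminals) and a finite set $\Delta\subseteq\Xi\times(\Xi\cup\mathcal A)^*$ of productions; every right-hand side is assumed to contain at most two terminals and at most two nonterminals. A step $u\Rightarrow v$ replaces one occurrence of a nonterminal $Y$ in $u$ by $w$, for some $(Y,w)\in\Delta$. The control word of a step sequence is the word of productions applied. A step sequence is depth-first if each step rewrites an occurrence of a nonterminal whose first appearance in the sequence is latest among all nonterminal occurrences present, and it is $k$-index if both words of each step contain at most $k$ occurrences of nonterminals. Write $u\Rightarrow^{\gamma}_{\mathbf{df}(k)}v$ (in $G$) if some depth-first $k$-index step sequence of $G$ with control word $\gamma$ leads from $u$ to $v$; here $k\ge 0$, and the empty step sequence is $0$-index. For $X\in\Xi$ and $Y\in\Xi\cup\{\varepsilon\}$ let $L_{X,Y}(G)=\{uv\in\mathcal A^*\mid X\Rightarrow^* u\,Y\,v\}$, and $L_X(G)=L_{X,\varepsilon}(G)$. Let $X\in\Xi$, $d\ge 3$, and let $a_1,\dots,a_d\in\mathcal A$ be distinct letters such that $L_X(G)\subseteq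 a_1^*\cdots a_d^*$ and this expression is minimal: $L_X(G)$ is not contained in any expression obtained from it by deleting some $a_i^*$. Let $\widehat\Xi$ be the set of $Y\in\Xi$ with $L_Y(G)\cap a_1\mathcal A^*\ne\emptyset$ and $L_Y(G)\cap\mathcal A^*a_d\ne\emptyset$, and $\check\Xi=\Xi\setminus\widehat\Xi$. Assume that each production $(Y,v)\in\Delta$ with $Y\in\widehat\Xi$ and $v\in(\check\Xi\cup\mathcal A)^*$ is such that $v$ has the form $a\,y\,b\,z$ with $a,b\in\mathcal A\cup\{\varepsilon\}$ and $y,z\in\Xi\cup\{\varepsilon\}$. Let $G^\sharp=\langle\Xi,\mathcal A,\Delta^\sharp\rangle$ with $$\Delta^\sharp=\{(Y,v)\in\Delta\mid Y\in\check\Xi\}\cup\{(Y,u\,Z\,v)\in\Delta\mid Y,Z\in\widehat\Xi\},$$ and, for $(X_i,v)\in\Delta$ with $X_i\in\widehat\Xi$ and $v\in(\check\Xi\cup\mathcal A)^*$, let $G_{i,v}=\langle\Xi,\mathcal A,\Delta_{i,v}\rangle$ with $\Delta_{i,v}=\{(Y,v')\in\Delta\mid Y\in\check\Xi\}\cup\{(X_i,v)\}$.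 Then for every $k>0$, $w\in\mathcal A^*$ and $\gamma\in\Delta^*$ with $X\Rightarrow^{\gamma}_{\mathbf{df}(k)}w$ in $G$, there exist a production $p=(X_i,a\,y\,b\,z)\in\Delta$ with $X_i\in\widehat\Xi$, $a,b\in\mathcal A\cup\{\varepsilon\}$, $y,z\in\check\Xi\cup\{\varepsilon\}$, and control words $\gamma^\sharp\in(\Delta^\sharp)^*$ and $\gamma_y,\gamma_z\in(\Delta_{i,aybz})^*$ such that $\gamma^\sharp\,p\,\gamma_y\,\gamma_z$ is a permutation of $\gamma$ and the following hold, for some $u_y,u_z\in\mathcal A^*$. 1. $X\Rightarrow^{\gamma^\sharp}_{\mathbf{df}(k+1)}u\,X_i\,v$ in $G^\sharp$ for some $u,v\in\mathcal A^*$. 2. $y\Rightarrow^{\gamma_y}_{\mathbf{df}(k_y)}u_y$ and $z\Rightarrow^{\gamma_z}_{\mathbf{df}(k_z)}u_z$ in $G_{i,aybz}$, for some integers $k_y,k_z\ge 0$ with $\max(k_y,k_z)\le k$ and $\min(k_y,k_z)\le k-1$; if $k\ge 2$, then $k_y,k_z>0$ can be taken. 3. If $y\Rightarrow^{\gamma_y}_{\mathbf{df}(k-1)}u_y$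 in $G_{i,aybz}$, then $X\Rightarrow^{\gamma^\sharp p\,\gamma_y\gamma_z}_{\mathbf{df}(k+1)}w$ in $G$; if $z\Rightarrow^{\gamma_z}_{\mathbf{df}(k-1)}u_z$ in $G_{i,aybz}$, then $X\Rightarrow^{\gamma^\sharp p\,\gamma_z\gamma_y}_{\mathbf{df}(k+1)}w$ in $G$. 4. $L_{X,X_i}(G^\sharp)\subseteq a_1^*a_d^*$. 5. There are integers $1\le\ell\le m\le r\le d$ with $\max(m-\ell,r-m)<d-1$ such that $L_y(G_{i,aybz})\subseteq a_\ell^*\cdots a_m^*$ if $y\in\check\Xi$, and $L_z(G_{i,aybz})\subseteq a_m^*\cdots a_r^*$ if $z\in\check\Xi$. -/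

import Mathlib

namespace IndexedCFG

/-- A context-free grammar (without axiom) over terminals `T` and nonterminals `N`:
a finite set of productions `(X, w)` with `X` in `N` and `w` a word over `T ∪ N`. -/
structure Grammar (T N : Type*) where
  prods : Set (ContextFreeRule T N)
  finite_prods : prods.Finite

variable {T N : Type*}

/-- The word consisting of a nonterminal, or the empty word. -/
def ntWord (y : Option N) : List (Symbol T N) := y.toList.map Symbol.nonterminal

/-- The word consisting of a terminal, or the empty word. -/
def tWord (a : Option T) : List (Symbol T N) := a.toList.map Symbol.terminal

/-- A terminal word seen as a word over terminals and nonterminals. -/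
def tstr (w : List T) : List (Symbol T N) := w.map Symbol.terminal

/-- The word `a y b z` with `a`, `b` terminals or empty and `y`, `z` nonterminals or empty. -/
def aybz (a : Option T) (y : Option N) (b : Option T) (z : Option N) : List (Symbol T N) :=
  tWord a ++ ntWord y ++ tWord b ++ ntWord z

/-- Number of occurrences of nonterminals in a word. -/
def numNonterminals (w : List (Symbol T N)) : ℕ :=
  w.countP (fun s => match s with
    | Symbol.nonterminal _ => true
    | Symbol.terminal _ => false)

/-- Number of occurrences of terminals in a word. -/
def numTerminals (w : List (Symbol T N)) : ℕ :=
  w.countP (fun s => match s with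
    | Symbol.nonterminal _ => false
    | Symbol.terminal _ => true)

/-- Every right-hand side has at most two terminals and at most two nonterminals. -/
def Grammar.IsGeneralForm (G : Grammar T N) : Prop :=
  ∀ r ∈ G.prods, numTerminals r.output ≤ 2 ∧ numNonterminals r.output ≤ 2

/-- `u ⇒* v` in `G`. -/
def Grammar.Derives (G : Grammar T N) : List (Symbol T N) → List (Symbol T N) → Prop :=
  Relation.ReflTransGen (fun u v => ∃ r ∈ G.prods, r.Rewrites u v)

/-- `L_{X,Y}(G)`, where `Y = none` stands for the empty word: all terminal words `u v` with
`X ⇒* u Y v`. -/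
def Grammar.langTo (G : Grammar T N) (X : N) (Y : Option N) : Language T :=
  {w | ∃ u v : List T, w = u ++ v ∧
    G.Derives [Symbol.nonterminal X] (tstr u ++ ntWord Y ++ tstr v)}

/-- `L_X(G)`. -/
def Grammar.lang (G : Grammar T N) (X : N) : Language T := G.langTo X none

/-- `G.DatedRun k m U γ V`: a depth-first `k`-index step sequence with control word `γ`, seen from
its `m`-th word on. Every occurrence of a symbol carries the number of the first word of the
sequence in which it appears: `U` is the `m`-th word with these dates, and `V` the last word.
A step rewrites a nonterminal occurrence of maximal date among all nonterminal occurrences, and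
both of its words have at most `k` nonterminal occurrences. -/
inductive Grammar.DatedRun (G : Grammar T N) (k : ℕ) :
    ℕ → List (Symbol T N × ℕ) → List (ContextFreeRule T N) → List (Symbol T N × ℕ) → Prop
  | nil (m : ℕ) (U : List (Symbol T N × ℕ)) : Grammar.DatedRun G k m U [] U
  | cons {m t : ℕ} {r : ContextFreeRule T N} {U P S V : List (Symbol T N × ℕ)}
      {γ : List (ContextFreeRule T N)}
      (mem : r ∈ G.prods)
      (word : U = P ++ [(Symbol.nonterminal r.input, t)] ++ S)
      (depthFirst : ∀ (Y : N) (t' : ℕ), (Symbol.nonterminal Y, t') ∈ P ++ S → t' ≤ t)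
      (index_before :
        numNonterminals (U.map Prod.fst) ≤ k)
      (index_after :
        numNonterminals ((P ++ r.output.map (fun s => (s, m + 1)) ++ S).map Prod.fst) ≤ k)
      (rest : Grammar.DatedRun G k (m + 1) (P ++ r.output.map (fun s => (s, m + 1)) ++ S) γ V) :
      Grammar.DatedRun G k m U (r :: γ) V

/-- There is a depth-first `k`-index step sequence of `G` from `u` to `v` with control
word `γ`. -/
def Grammar.DFDerives (G : Grammar T N) (k : ℕ) (u : List (Symbol T N))
    (γ : List (ContextFreeRule T N)) (v : List (Symbol T N)) : Prop :=
  ∃ V : List (Symbol T N × ℕ), V.map Prod.fst = v ∧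
    G.DatedRun k 0 (u.map (fun s => (s, 0))) γ V

/-- The language `a_{i₁}* ⋯ a_{iₛ}*` for the list of indices `[i₁, …, iₛ]`. -/
def letterBounded (a : ℕ → T) (I : List ℕ) : Language T :=
  (I.map (fun i => KStar.kstar ({[a i]} : Language T))).prod

/-- The language `a_l* a_{l+1}* ⋯ a_m*`. -/
def segment (a : ℕ → T) (l m : ℕ) : Language T :=
  letterBounded a (List.range' l (m + 1 - l))

/-- `a_1* ⋯ a_d*` contains `L`, and no expression obtained by deleting some `a_i*` does. -/
def IsMinimalFor (a : ℕ → T) (d : ℕ) (L : Language T) : Prop :=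
  L ≤ segment a 1 d ∧
    ∀ i ∈ Set.Icc 1 d, ¬ L ≤ letterBounded a ((List.range' 1 d).erase i)

/-- The nonterminals `Y` such that `L_Y(G)` contains a word starting with `c` and a word ending
with `e`. -/
def Grammar.hat (G : Grammar T N) (c e : T) : Set N :=
  {Y | (∃ w : List T, c :: w ∈ G.lang Y) ∧ (∃ w : List T, w ++ [e] ∈ G.lang Y)}

/-- The complement of `hat`. -/
def Grammar.check (G : Grammar T N) (c e : T) : Set N := (G.hat c e)ᶜ

/-- The grammar `G♯`: the productions with head in `check`, and those with head in `hat` whose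
right-hand side is `u X_r v` with `X_r` in `hat`. -/
def Grammar.sharp (G : Grammar T N) (c e : T) : Grammar T N where
  prods := {r | r ∈ G.prods ∧ r.input ∈ G.check c e} ∪
    {r | r ∈ G.prods ∧ r.input ∈ G.hat c e ∧ ∃ Xr ∈ G.hat c e, ∃ u v : List (Symbol T N),
      r.output = u ++ [Symbol.nonterminal Xr] ++ v}
  finite_prods := G.finite_prods.subset (by
    rintro r (h | h)
    · exact h.1
    · exact h.1)

/-- The grammar `G_{i,w}` of a production `p = (X_i, w)`: the productions with head in `check`,
and `p`. -/
def Grammar.pivot (G : Grammar T N) (c e : T) (p : ContextFreeRule T N) : Grammar T N where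
  prods := {r | r ∈ G.prods ∧ r.input ∈ G.check c e} ∪ {p}
  finite_prods := (G.finite_prods.subset (fun _ h => h.1)).union (Set.finite_singleton p)

/-- Every production with head in `hat` and no nonterminal of `hat` on its right-hand side is of
the form `(X_i, a y b z)`. -/
def Grammar.PivotsAreAybz (G : Grammar T N) (c e : T) : Prop :=
  ∀ r ∈ G.prods, r.input ∈ G.hat c e →
    (∀ Y : N, Symbol.nonterminal Y ∈ r.output → Y ∈ G.check c e) →
    ∃ (a b : Option T) (y z : Option N), r.output = aybz a y b z

end IndexedCFG

/-!
Write "hat" for the nonterminals that generate both a word starting with `a 1` and a word ending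
with `a d`, and "check" for the others.

Consider the derivation tree of a word of `L_X(G) ⊆ a_1* ⋯ a_d*`. Around a hat nonterminal only
letters `a 1` on the left and `a d` on the right can be generated (`letters_around_hat`). Hence
every node above a hat node is a hat node (`mem_hat_of_reaches`), and no node has two hat children
(`not_two_hats`), since the left one could generate `a d` before an `a 1` of the right one. As `X`
itself is a hat nonterminal by minimality, the hat nodes form one path from the root, the spine; it
ends with a production `p = (X_i, a y b z)` with `y` and `z` check, and all nodes off the spine are
check nodes.

A depth-first run treats the nonterminals of one right-hand side one after the other, each of them
completely. The relation `Grammar.BlockRun` records this recursive structure without dates: a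
nonterminal treated while `n` others wait has a run of index `k - n`. The dated runs of the
definition and the runs by blocks agree on complete derivations (`Grammar.DFDerives.blockRun`,
`Grammar.BlockRun.exists_datedRun`). From a run by blocks the run of a single nonterminal can be
extracted, and the rest remains a run in which that nonterminal waits until the end, at the cost of
one more unit of index (`Grammar.BlockRun.extract`). Applied along the spine this postpones the
spine nonterminal behind its siblings (`Grammar.BlockRun.exists_spine`), and yields `γ♯` with index
`k + 1`. Below `p`, whichever of `y` and `z` is treated first has index at most `k - 1`, because the
other one waits (`Grammar.BlockRun.of_pair`).

For the languages, all indices of letters generated by `y` are at most those generated by `z`, and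
neither branch generates words that start with `a 1` and words that end with `a d`. Since `3 ≤ d`,
there is a cut point between the two sets of indices that leaves a proper segment on both sides
(`exists_cut`).
-/

namespace IndexedCFG

variable {T N : Type*} {G : Grammar T N}

/-! ### Words -/

@[simp] lemma numNonterminals_nil : numNonterminals ([] : List (Symbol T N)) = 0 := rfl

@[simp] lemma numNonterminals_append (u v : List (Symbol T N)) :
    numNonterminals (u ++ v) = numNonterminals u + numNonterminals v :=
  List.countP_append

@[simp] lemma numNonterminals_cons_nonterminal (Y : N) (u : List (Symbol T N)) :
    numNonterminals (Symbol.nonterminal Y :: u) = numNonterminals u + 1 := by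
  simp [numNonterminals]

@[simp] lemma numNonterminals_cons_terminal (x : T) (u : List (Symbol T N)) :
    numNonterminals (Symbol.terminal x :: u) = numNonterminals u := by
  simp [numNonterminals]

@[simp] lemma numNonterminals_tstr (w : List T) :
    numNonterminals (tstr w : List (Symbol T N)) = 0 := by
  induction w with
  | nil => rfl
  | cons x w ih => simpa [tstr] using ih

lemma numNonterminals_ntWord_le (y : Option N) :
    numNonterminals (ntWord y : List (Symbol T N)) ≤ 1 := by
  cases y <;> simp [ntWord]

@[simp] lemma tstr_nil : (tstr [] : List (Symbol T N)) = [] := rfl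

@[simp] lemma tstr_append (u v : List T) :
    (tstr (u ++ v) : List (Symbol T N)) = tstr u ++ tstr v := by
  simp [tstr]

@[simp] lemma tstr_inj {u v : List T} : (tstr u : List (Symbol T N)) = tstr v ↔ u = v :=
  List.map_inj_right fun _ _ h => Symbol.terminal.inj h

@[simp] lemma nonterminal_notMem_tstr (Y : N) (w : List T) :
    Symbol.nonterminal Y ∉ (tstr w : List (Symbol T N)) := by
  simp [tstr]

lemma tWord_eq_tstr (b : Option T) : (tWord b : List (Symbol T N)) = tstr b.toList := rfl

lemma tstr_eq_append {w : List T} {U V : List (Symbol T N)} (h : tstr w = U ++ V) :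
    ∃ u v, w = u ++ v ∧ U = tstr u ∧ V = tstr v := by
  obtain ⟨u, v, rfl, rfl, rfl⟩ := List.map_eq_append_iff.1 h
  exact ⟨u, v, rfl, rfl, rfl⟩

lemma exists_tstr_or_nonterminal_mem (U : List (Symbol T N)) :
    (∃ u, U = tstr u) ∨ ∃ Y, Symbol.nonterminal Y ∈ U := by
  induction U with
  | nil => exact Or.inl ⟨[], rfl⟩
  | cons s U ih =>
    cases s with
    | nonterminal Y => exact Or.inr ⟨Y, by simp⟩
    | terminal x =>
      rcases ih with ⟨u, rfl⟩ | ⟨Y, hY⟩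
      · exact Or.inl ⟨x :: u, rfl⟩
      · exact Or.inr ⟨Y, by simp [hY]⟩

/-- A letter in a product of two words lies in one of the factors. -/
lemma append_eq_append_singleton_append {α : Type*} {A B P S : List α} {x : α}
    (h : A ++ B = P ++ [x] ++ S) :
    (∃ E, A = P ++ [x] ++ E ∧ S = E ++ B) ∨ ∃ E, P = A ++ E ∧ B = E ++ [x] ++ S := by
  rw [List.append_assoc, List.append_eq_append_iff] at h
  rcases h with ⟨E, rfl, h⟩ | ⟨E, rfl, h⟩
  · exact Or.inr ⟨E, rfl, by simpa using h⟩
  · rcases E with _ | ⟨e, E⟩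
    · exact Or.inr ⟨[], by simp, by simpa using h.symm⟩
    · obtain ⟨rfl, rfl⟩ := List.cons.inj (by simpa using h)
      exact Or.inl ⟨E, by simp, rfl⟩

/-- Two marked letters of a word coincide, or one lies to the left of the other. -/
lemma append_singleton_append_eq {α : Type*} {P S A B : List α} {x y : α}
    (h : P ++ [x] ++ S = A ++ [y] ++ B) :
    (P = A ∧ x = y ∧ S = B) ∨ (∃ E, P = A ++ [y] ++ E ∧ B = E ++ [x] ++ S) ∨
      ∃ E, A = P ++ [x] ++ E ∧ S = E ++ [y] ++ B := by
  rcases append_eq_append_singleton_append (A := P ++ [x]) h with ⟨E, h₁, rfl⟩ | ⟨E, h₁, h₂⟩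
  · rcases append_eq_append_singleton_append h₁ with ⟨F, rfl, rfl⟩ | ⟨F, rfl, h₂⟩
    · exact Or.inr (Or.inl ⟨F, by simp, by simp⟩)
    · rcases F with _ | ⟨f, F⟩
      · obtain ⟨rfl, rfl⟩ := List.cons.inj (by simpa using h₂)
        exact Or.inl (by simp)
      · simp at h₂
  · exact Or.inr (Or.inr ⟨E, h₁, h₂⟩)

/-! ### Depth-first runs by blocks -/

/-- `G.BlockRun k U γ W`: a depth-first `k`-index step sequence from `U` to `W` with control word
`γ`, described without dates. All nonterminals of `U` count as having the same date, so they may be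
rewritten in any order, but the right-hand side put in place of one of them must be turned into a
terminal word `x` before the next one is touched. Meanwhile the other nonterminals wait, so that
the index `j` of this inner run and the number of waiting nonterminals add up to at most `k`. -/
inductive Grammar.BlockRun (G : Grammar T N) :
    ℕ → List (Symbol T N) → List (ContextFreeRule T N) → List (Symbol T N) → Prop
  | nil {k : ℕ} {U : List (Symbol T N)} (le : numNonterminals U ≤ k) : Grammar.BlockRun G k U [] U
  | cons {k j : ℕ} {r : ContextFreeRule T N} {P S W : List (Symbol T N)} {x : List T}
      {γ γ' : List (ContextFreeRule T N)}
      (mem : r ∈ G.prods) (pos : 1 ≤ j) (le : j + numNonterminals (P ++ S) ≤ k)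
      (block : Grammar.BlockRun G j r.output γ (tstr x))
      (rest : Grammar.BlockRun G k (P ++ tstr x ++ S) γ' W) :
      Grammar.BlockRun G k (P ++ [Symbol.nonterminal r.input] ++ S) (r :: (γ ++ γ')) W

lemma Grammar.BlockRun.numNonterminals_le {k : ℕ} {U W : List (Symbol T N)}
    {γ : List (ContextFreeRule T N)} (h : G.BlockRun k U γ W) : numNonterminals U ≤ k := by
  cases h with
  | nil le => exact le
  | cons mem pos le block rest => simp at le ⊢; omega

lemma Grammar.BlockRun.mono_index {k l : ℕ} {U W : List (Symbol T N)}
    {γ : List (ContextFreeRule T N)} (h : G.BlockRun k U γ W) (hkl : k ≤ l) :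
    G.BlockRun l U γ W := by
  induction h generalizing l with
  | nil le => exact .nil (le.trans hkl)
  | cons mem pos le block rest _ ih => exact .cons mem pos (le.trans hkl) block (ih hkl)

lemma Grammar.BlockRun.trans {k : ℕ} {U V W : List (Symbol T N)}
    {γ γ' : List (ContextFreeRule T N)} (h : G.BlockRun k U γ V) (h' : G.BlockRun k V γ' W) :
    G.BlockRun k U (γ ++ γ') W := by
  induction h with
  | nil le => exact h'
  | cons mem pos le block rest _ ih =>
    simpa using Grammar.BlockRun.cons mem pos le block (ih h')

lemma Grammar.BlockRun.append {k l : ℕ} {U W : List (Symbol T N)}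
    {γ : List (ContextFreeRule T N)} (h : G.BlockRun k U γ W) (P S : List (Symbol T N))
    (hl : k + numNonterminals (P ++ S) ≤ l) : G.BlockRun l (P ++ U ++ S) γ (P ++ W ++ S) := by
  induction h generalizing l with
  | nil le => exact .nil (by simp at hl ⊢; omega)
  | @cons k j r P' S' W x γ γ' mem pos le block rest _ ih =>
    have := ih hl
    have := Grammar.BlockRun.cons (P := P ++ P') (S := S' ++ S) (k := l) mem pos
      (by simp at hl le ⊢; omega) block (by simpa using this)
    simpa using this

lemma Grammar.BlockRun.mem_prods {k : ℕ} {U W : List (Symbol T N)}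
    {γ : List (ContextFreeRule T N)} (h : G.BlockRun k U γ W) : ∀ r ∈ γ, r ∈ G.prods := by
  induction h with
  | nil => simp
  | cons mem pos le block rest ih₁ ih₂ =>
    intro s hs
    simp only [List.mem_cons, List.mem_append] at hs
    rcases hs with rfl | hs | hs
    exacts [mem, ih₁ s hs, ih₂ s hs]

/-- A run from a terminal word is empty. -/
lemma Grammar.BlockRun.of_tstr {k : ℕ} {u : List T} {W : List (Symbol T N)}
    {γ : List (ContextFreeRule T N)} (h : G.BlockRun k (tstr u) γ W) : γ = [] ∧ W = tstr u := by
  generalize hU : tstr u = U at h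
  cases h with
  | nil => exact ⟨rfl, rfl⟩
  | @cons _ _ r =>
    have := nonterminal_notMem_tstr r.input u
    simp [hU] at this

/-- A complete run from a nonterminal is a production followed by a run of its right-hand side. -/
lemma Grammar.BlockRun.of_nonterminal {k : ℕ} {Y : N} {w : List T}
    {γ : List (ContextFreeRule T N)} (h : G.BlockRun k [Symbol.nonterminal Y] γ (tstr w)) :
    ∃ r ∈ G.prods, r.input = Y ∧ ∃ γ', γ = r :: γ' ∧ G.BlockRun k r.output γ' (tstr w) := by
  generalize hU : [Symbol.nonterminal Y] = U at h
  generalize hW : tstr w = W at h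
  cases h with
  | nil => simpa [← hW] using congrArg numNonterminals hU
  | @cons _ j r P S _ x γ γ' mem pos le block rest =>
    obtain ⟨rfl, hr, rfl⟩ : P = [] ∧ r.input = Y ∧ S = [] := by
      rcases append_singleton_append_eq (A := []) (B := []) (by simpa using hU.symm) with
        ⟨h₁, h₂, h₃⟩ | ⟨E, -, h⟩ | ⟨E, h, -⟩
      · exact ⟨h₁, Symbol.nonterminal.inj h₂, h₃⟩
      · simp at h
      · simp at h
    obtain ⟨rfl, rfl⟩ := Grammar.BlockRun.of_tstr (by simpa using rest)
    exact ⟨r, mem, hr, γ, by simp, block.mono_index (by simpa using le)⟩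

lemma Grammar.BlockRun.singleton {k : ℕ} {r : ContextFreeRule T N} {w : List T}
    {γ : List (ContextFreeRule T N)} (mem : r ∈ G.prods) (hk : 1 ≤ k)
    (h : G.BlockRun k r.output γ (tstr w)) :
    G.BlockRun k [Symbol.nonterminal r.input] (r :: γ) (tstr w) := by
  simpa using Grammar.BlockRun.cons (k := k) (γ' := []) (W := tstr w) (P := []) (S := []) mem hk
    (by simp) h (by simpa using .nil (by simp))

/-! ### Dated runs and runs by blocks -/

lemma Grammar.DatedRun.trans {k m : ℕ} {U V W : List (Symbol T N × ℕ)}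
    {γ γ' : List (ContextFreeRule T N)} (h : G.DatedRun k m U γ V)
    (h' : G.DatedRun k (m + γ.length) V γ' W) : G.DatedRun k m U (γ ++ γ') W := by
  induction h with
  | nil => exact h'
  | cons mem word df ib ia rest ih =>
    exact .cons mem word df ib ia (ih (by rw [List.length_cons] at h'; convert h' using 1; omega))

lemma Grammar.DatedRun.mono {G' : Grammar T N} {k m : ℕ} {U V : List (Symbol T N × ℕ)}
    {γ : List (ContextFreeRule T N)} (h : G.DatedRun k m U γ V) (hγ : ∀ r ∈ γ, r ∈ G'.prods) :
    G'.DatedRun k m U γ V := by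
  induction h with
  | nil => exact .nil _ _
  | cons mem word df ib ia rest ih =>
    exact .cons (hγ _ (by simp)) word df ib ia (ih fun r hr => hγ r (by simp [hr]))

lemma Grammar.DFDerives.mono {G' : Grammar T N} {k : ℕ} {u v : List (Symbol T N)}
    {γ : List (ContextFreeRule T N)} (h : G.DFDerives k u γ v) (hγ : ∀ r ∈ γ, r ∈ G'.prods) :
    G'.DFDerives k u γ v :=
  let ⟨V, hV, h⟩ := h
  ⟨V, hV, h.mono hγ⟩

lemma exists_mem_of_map_fst {D : List (Symbol T N × ℕ)} {U : List (Symbol T N)} {Y : N}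
    (hD : D.map Prod.fst = U) (hY : Symbol.nonterminal Y ∈ U) :
    ∃ t, (Symbol.nonterminal Y, t) ∈ D := by
  subst hD
  obtain ⟨⟨s, t⟩, h, rfl⟩ := List.mem_map.1 hY
  exact ⟨t, h⟩

lemma notMem_of_map_fst_eq_tstr {D : List (Symbol T N × ℕ)} {w : List T}
    (hD : D.map Prod.fst = tstr w) (Y : N) (t : ℕ) : (Symbol.nonterminal Y, t) ∉ D := fun h =>
  nonterminal_notMem_tstr Y w (hD ▸ List.mem_map_of_mem (f := Prod.fst) h)

/-- A run by blocks is a depth-first run, also inside a context whose nonterminals are not younger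
than those of the block. -/
lemma Grammar.BlockRun.exists_datedRun {j : ℕ} {U W : List (Symbol T N)}
    {γ : List (ContextFreeRule T N)} (h : G.BlockRun j U γ W) :
    ∀ {k m t : ℕ} {P D S : List (Symbol T N × ℕ)}, D.map Prod.fst = U →
      (∀ Y t', (Symbol.nonterminal Y, t') ∈ D → t' = t) →
      (∀ Y t', (Symbol.nonterminal Y, t') ∈ P ++ S → t' ≤ t) → t ≤ m →
      j + numNonterminals ((P ++ S).map Prod.fst) ≤ k →
      ∃ E, E.map Prod.fst = W ∧ (∀ Y t', (Symbol.nonterminal Y, t') ∈ E → t' = t) ∧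
        G.DatedRun k m (P ++ D ++ S) γ (P ++ E ++ S) := by
  induction h with
  | nil le => exact fun {k m t P D S} hU hD hPS htm hk => ⟨D, hU, hD, .nil _ _⟩
  | @cons l j r P' S' W x γ γ' mem pos le block rest ih₁ ih₂ =>
    intro k m t P D S hU hD hPS htm hk
    obtain ⟨D', D₂, rfl, hD', rfl⟩ := List.map_eq_append_iff.1 hU
    obtain ⟨D₁, D₀, rfl, rfl, h₀⟩ := List.map_eq_append_iff.1 hD'
    obtain ⟨⟨s, t₀⟩, rfl, hs : s = _⟩ := List.map_eq_singleton_iff.1 h₀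
    subst hs
    obtain rfl : t₀ = t := hD r.input t₀ (by simp)
    have hdate : ∀ Y t', (Symbol.nonterminal Y, t') ∈ (P ++ D₁) ++ (D₂ ++ S) → t' ≤ t₀ := by
      intro Y t' h
      simp only [List.mem_append] at h
      rcases h with (h | h) | (h | h)
      · exact hPS Y t' (by simp [h])
      · exact (hD Y t' (by simp [h])).le
      · exact (hD Y t' (by simp [h])).le
      · exact hPS Y t' (by simp [h])
    have hout := block.numNonterminals_le
    obtain ⟨E₁, hE₁, -, run₁⟩ := ih₁ (k := k) (m := m + 1) (t := m + 1) (P := P ++ D₁)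
      (D := r.output.map (fun s => (s, m + 1))) (S := D₂ ++ S)
      (by simp [Function.comp_def]) (by simp +contextual)
      (fun Y t' h => (hdate Y t' h).trans (by omega)) le_rfl
      (by simp at le hk ⊢; omega)
    obtain ⟨E, hE, hEt, run₂⟩ := ih₂ (k := k) (m := m + 1 + γ.length) (t := t₀) (P := P)
      (D := D₁ ++ E₁ ++ D₂) (S := S) (by simp [hE₁])
      (by
        intro Y t' h
        simp only [List.mem_append] at h
        rcases h with (h | h) | h
        · exact hD Y t' (by simp [h])
        · exact absurd h (notMem_of_map_fst_eq_tstr hE₁ Y t')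
        · exact hD Y t' (by simp [h]))
      hPS (by omega) hk
    refine ⟨E, hE, hEt, .cons (P := P ++ D₁) (S := D₂ ++ S) (t := t₀) mem (by simp) hdate
      (by simp at le hk ⊢; omega)
      (by simp [Function.comp_def] at le hk ⊢; omega) (.trans run₁ ?_)⟩
    simpa using run₂

/-- In a depth-first run ending in a terminal word, the nonterminals that are the youngest at some
moment (those of `D`) are rewritten completely before any other one. Those of `P` and `S` wait and
lower the index. -/
lemma Grammar.DatedRun.exists_blockRun : ∀ (n : ℕ) {k m t : ℕ}
    {γ : List (ContextFreeRule T N)} {P D S V : List (Symbol T N × ℕ)}, γ.length ≤ n →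
    G.DatedRun k m (P ++ D ++ S) γ V → (∃ v, V.map Prod.fst = tstr v) →
    (∀ Y t', (Symbol.nonterminal Y, t') ∈ D → t' = t) →
    (∀ Y t', (Symbol.nonterminal Y, t') ∈ P ++ S → t' < t) → t ≤ m →
    ∃ γ₁ γ₂ w E, γ = γ₁ ++ γ₂ ∧
      G.BlockRun (k - numNonterminals ((P ++ S).map Prod.fst)) (D.map Prod.fst) γ₁ (tstr w) ∧
      E.map Prod.fst = tstr w ∧ G.DatedRun k (m + γ₁.length) (P ++ E ++ S) γ₂ V := by
  intro n
  induction n with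
  | zero => ?_
  | succ n ih => ?_
  all_goals
    intro k m t γ P D S V hn run hV hD hPS htm
    rcases exists_tstr_or_nonterminal_mem (D.map Prod.fst) with ⟨w, hw⟩ | ⟨Y, hY⟩
    · exact ⟨[], γ, w, D, rfl, by simpa [hw] using .nil (by simp), hw, run⟩
    obtain ⟨tY, hYD⟩ := exists_mem_of_map_fst rfl hY
    generalize hU : P ++ D ++ S = U at run
    cases run with
    | nil =>
      obtain ⟨v, hv⟩ := hV
      exact absurd (by simp [← hU, hYD]) (notMem_of_map_fst_eq_tstr hv Y tY)
    | @cons _ t₁ r _ P₁ S₁ _ γ mem word df ib ia rest => ?_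
  · simp at hn
  -- The first step rewrites an occurrence of maximal date, hence one in `D`.
  · obtain rfl : tY = t := hD Y tY hYD
    have ht₁ : tY ≤ t₁ := by
      have : (Symbol.nonterminal Y, tY) ∈ U := by simp [← hU, hYD]
      rw [word] at this
      simp only [List.mem_append, List.mem_singleton, Prod.mk.injEq] at this
      rcases this with (h | h) | h
      · exact df Y tY (by simp [h])
      · exact h.2.le
      · exact df Y tY (by simp [h])
    obtain ⟨D₁, D₂, rfl, rfl, rfl⟩ : ∃ D₁ D₂, P₁ = P ++ D₁ ∧ S₁ = D₂ ++ S ∧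
        D = D₁ ++ [(Symbol.nonterminal r.input, t₁)] ++ D₂ := by
      rcases append_eq_append_singleton_append (hU.trans word) with ⟨E, h, rfl⟩ | ⟨E, rfl, rfl⟩
      · rcases append_eq_append_singleton_append h with ⟨F, rfl, rfl⟩ | ⟨F, rfl, rfl⟩
        · exact absurd (hPS r.input t₁ (by simp)) (by omega)
        · exact ⟨F, E, rfl, rfl, rfl⟩
      · exact absurd (hPS r.input t₁ (by simp)) (by omega)
    obtain rfl : t₁ = tY := hD r.input t₁ (by simp)
    -- Its right-hand side is now the youngest part of the word, and `D` is so again afterwards.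
    obtain ⟨γ₁, γ₂, x, E, rfl, block, hE, run⟩ := ih (t := m + 1) (P := P ++ D₁)
      (D := r.output.map (fun s => (s, m + 1))) (S := D₂ ++ S) (by simpa using hn) rest hV
      (by simp +contextual)
      (by
        intro Y t' h
        have := df Y t' h
        omega)
      le_rfl
    obtain ⟨γ₃, γ₄, w, E', rfl, block', hE', run'⟩ := ih (t := t₁) (P := P)
      (γ := γ₂) (D := D₁ ++ E ++ D₂) (S := S) (by simp at hn; omega) (by simpa using run) hV
      (by
        intro Y t' h
        simp only [List.mem_append] at h
        rcases h with (h | h) | h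
        · exact hD Y t' (by simp [h])
        · exact absurd h (notMem_of_map_fst_eq_tstr hE Y t')
        · exact hD Y t' (by simp [h]))
      hPS (by omega)
    refine ⟨r :: (γ₁ ++ γ₃), γ₄, w, E', by simp, ?_, hE', ?_⟩
    · have hib : 1 + numNonterminals ((P ++ D₁ ++ (D₂ ++ S)).map Prod.fst) ≤ k := by
        rw [word] at ib
        simp at ib ⊢
        omega
      have := Grammar.BlockRun.cons (P := D₁.map Prod.fst) (S := D₂.map Prod.fst)
        (k := k - numNonterminals ((P ++ S).map Prod.fst))
        (j := k - numNonterminals ((P ++ D₁ ++ (D₂ ++ S)).map Prod.fst)) mem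
        (by omega) (by simp at hib ⊢; omega)
        (by simpa [Function.comp_def] using block) (by simpa [hE] using block')
      simpa using this
    · simpa [Nat.add_assoc, Nat.add_comm, Nat.add_left_comm] using run'

lemma Grammar.DFDerives.blockRun {k : ℕ} {X : N} {γ : List (ContextFreeRule T N)} {w : List T}
    (h : G.DFDerives k [Symbol.nonterminal X] γ (tstr w)) :
    G.BlockRun k [Symbol.nonterminal X] γ (tstr w) := by
  obtain ⟨V, hV, run⟩ := h
  obtain ⟨γ₁, γ₂, w', E, rfl, block, hE, run'⟩ := run.exists_blockRun γ.length (t := 0) (P := [])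
    (S := []) (D := [(Symbol.nonterminal X, 0)]) le_rfl ⟨w, hV⟩ (by simp) (by simp) le_rfl
  generalize hU : [] ++ E ++ [] = U at run'
  cases run' with
  | nil =>
    obtain rfl : w' = w := by simpa [hV, hE] using congrArg (List.map Prod.fst) hU
    simpa using block
  | @cons _ t r _ P S _ γ mem word =>
    refine absurd ?_ (notMem_of_map_fst_eq_tstr hE r.input t)
    rw [word] at hU
    simpa using congrArg ((Symbol.nonterminal r.input, t) ∈ ·) hU

lemma Grammar.BlockRun.dfDerives {k : ℕ} {U W : List (Symbol T N)}
    {γ : List (ContextFreeRule T N)} (h : G.BlockRun k U γ W) : G.DFDerives k U γ W := by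
  obtain ⟨E, hE, -, run⟩ := h.exists_datedRun (k := k) (m := 0) (t := 0) (P := []) (S := [])
    (D := U.map fun s => (s, 0)) (by simp [Function.comp_def]) (by simp) (by simp) le_rfl (by simp)
  exact ⟨E, hE, by simpa using run⟩

/-! ### Extracting the run of one nonterminal -/

/-- A terminal factor of the initial word plays no role in a run, and can be replaced by an
arbitrary word `M`, whose nonterminals are then left waiting. -/
lemma Grammar.BlockRun.replace_tstr {k : ℕ} {U W A B : List (Symbol T N)}
    {γ : List (ContextFreeRule T N)} {x w : List T} (h : G.BlockRun k U γ W)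
    (hU : U = A ++ tstr x ++ B) (hW : W = tstr w) :
    ∃ u v, w = u ++ x ++ v ∧
      ∀ M, G.BlockRun (k + numNonterminals M) (A ++ M ++ B) γ (tstr u ++ M ++ tstr v) := by
  induction h generalizing A B with
  | nil le =>
    obtain ⟨u', v, rfl, h, rfl⟩ := tstr_eq_append (hW.symm.trans hU)
    obtain ⟨u, x', rfl, rfl, h'⟩ := tstr_eq_append h.symm
    obtain rfl := tstr_inj.1 h'
    exact ⟨u, v, rfl, fun M => .nil (by simp)⟩
  | @cons k j r P S W y γ γ' mem pos le block rest _ ih =>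
    rcases append_eq_append_singleton_append hU.symm with ⟨E, h, rfl⟩ | ⟨E, rfl, rfl⟩
    · rcases append_eq_append_singleton_append h with ⟨F, rfl, rfl⟩ | ⟨F, rfl, h'⟩
      · obtain ⟨u, v, rfl, hM⟩ := ih (A := P ++ tstr y ++ F) (B := B) (by simp) hW
        refine ⟨u, v, rfl, fun M => ?_⟩
        have := Grammar.BlockRun.cons (P := P) (S := F ++ M ++ B) (k := k + numNonterminals M) mem
          pos (by simp at le ⊢; omega) block (by simpa using hM M)
        simpa using this
      · exact absurd (by simp [h']) (nonterminal_notMem_tstr r.input x)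
    · obtain ⟨u, v, rfl, hM⟩ := ih (A := A) (B := E ++ tstr y ++ S) (by simp) hW
      refine ⟨u, v, rfl, fun M => ?_⟩
      have := Grammar.BlockRun.cons (P := A ++ M ++ E) (S := S) (k := k + numNonterminals M) mem
        pos (by simp at le ⊢; omega) block (by simpa using hM M)
      simpa using this

/-- From a complete run one can extract the part that rewrites a given nonterminal `H` of the
initial word; what is left is a run in which an arbitrary word `M` waits in place of `H`. -/
lemma Grammar.BlockRun.extract {k : ℕ} {U W A B : List (Symbol T N)} {H : N}
    {γ : List (ContextFreeRule T N)} {w : List T} (h : G.BlockRun k U γ W)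
    (hU : U = A ++ [Symbol.nonterminal H] ++ B) (hW : W = tstr w) :
    ∃ γ' γH u x v, γ.Perm (γ' ++ γH) ∧ w = u ++ x ++ v ∧
      G.BlockRun k [Symbol.nonterminal H] γH (tstr x) ∧
      ∀ M, G.BlockRun (k + numNonterminals M) (A ++ M ++ B) γ' (tstr u ++ M ++ tstr v) := by
  induction h generalizing A B with
  | nil le => exact absurd (by simp [← hW, hU]) (nonterminal_notMem_tstr H w)
  | @cons k j r P S W y γ γ' mem pos le block rest _ ih =>
    rcases append_singleton_append_eq hU with ⟨rfl, h, rfl⟩ | ⟨E, rfl, rfl⟩ | ⟨E, rfl, rfl⟩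
    · obtain rfl := Symbol.nonterminal.inj h
      obtain ⟨u, v, rfl, hM⟩ := rest.replace_tstr rfl hW
      have hjk : j ≤ k := by omega
      exact ⟨γ', r :: γ, u, y, v, by simpa using List.perm_append_comm (l₁ := r :: γ), rfl,
        .singleton mem (pos.trans hjk) (block.mono_index hjk), hM⟩
    · obtain ⟨γ₁, γH, u, x, v, hp, rfl, hH, hM⟩ :=
        ih (A := A) (B := E ++ tstr y ++ S) (by simp) hW
      refine ⟨r :: (γ ++ γ₁), γH, u, x, v, by simpa using hp.append_left γ, rfl, hH, fun M => ?_⟩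
      have := Grammar.BlockRun.cons (P := A ++ M ++ E) (S := S) (k := k + numNonterminals M) mem
        pos (by simp at le ⊢; omega) block (by simpa using hM M)
      simpa using this
    · obtain ⟨γ₁, γH, u, x, v, hp, rfl, hH, hM⟩ :=
        ih (A := P ++ tstr y ++ E) (B := B) (by simp) hW
      refine ⟨r :: (γ ++ γ₁), γH, u, x, v, by simpa using hp.append_left γ, rfl, hH, fun M => ?_⟩
      have := Grammar.BlockRun.cons (P := P) (S := E ++ M ++ B) (k := k + numNonterminals M) mem
        pos (by simp at le ⊢; omega) block (by simpa using hM M)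
      simpa using this

/-- A complete run from a word with a single nonterminal is a run from this nonterminal. -/
lemma Grammar.BlockRun.of_single {k : ℕ} {Y : N} {b c w : List T}
    {γ : List (ContextFreeRule T N)}
    (h : G.BlockRun k (tstr b ++ [Symbol.nonterminal Y] ++ tstr c) γ (tstr w)) :
    ∃ x, w = b ++ x ++ c ∧ G.BlockRun k [Symbol.nonterminal Y] γ (tstr x) := by
  generalize hU : tstr b ++ [Symbol.nonterminal Y] ++ tstr c = U at h
  generalize hW : tstr w = W at h
  cases h with
  | nil => exact absurd (by simp [hW, ← hU]) (nonterminal_notMem_tstr Y w)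
  | @cons _ j r P S _ x γ γ' mem pos le block rest =>
    rcases append_singleton_append_eq hU with ⟨rfl, h, rfl⟩ | ⟨E, h, -⟩ | ⟨E, -, h⟩
    · obtain rfl := Symbol.nonterminal.inj h
      obtain ⟨rfl, hw⟩ := Grammar.BlockRun.of_tstr (u := b ++ x ++ c) (by simpa using rest)
      have hjk : j ≤ k := by omega
      exact ⟨x, tstr_inj.1 (hW.trans hw), by
        simpa using Grammar.BlockRun.singleton mem (pos.trans hjk) (block.mono_index hjk)⟩
    · exact absurd (by simp [h]) (nonterminal_notMem_tstr r.input b)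
    · exact absurd (by simp [h]) (nonterminal_notMem_tstr r.input c)

/-- Of two nonterminals, the one rewritten first has a run of smaller index, since the other one is
waiting. -/
lemma Grammar.BlockRun.of_pair {k : ℕ} {Y Z : N} {b c e w : List T}
    {γ : List (ContextFreeRule T N)}
    (h : G.BlockRun k (tstr b ++ [Symbol.nonterminal Y] ++ tstr c ++ [Symbol.nonterminal Z] ++
      tstr e) γ (tstr w)) :
    ∃ γy γz uy uz ky kz, γ.Perm (γy ++ γz) ∧ w = b ++ uy ++ c ++ uz ++ e ∧
      G.BlockRun ky [Symbol.nonterminal Y] γy (tstr uy) ∧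
      G.BlockRun kz [Symbol.nonterminal Z] γz (tstr uz) ∧
      0 < ky ∧ 0 < kz ∧ max ky kz ≤ k ∧ min ky kz ≤ k - 1 := by
  generalize hU : tstr b ++ [Symbol.nonterminal Y] ++ tstr c ++ [Symbol.nonterminal Z] ++
      tstr e = U at h
  generalize hW : tstr w = W at h
  cases h with
  | nil => exact absurd (by simp [hW, ← hU]) (nonterminal_notMem_tstr Y w)
  | @cons _ j r P S _ x γ γ' mem pos le block rest =>
    rcases append_singleton_append_eq hU with ⟨rfl, h, rfl⟩ | ⟨E, h, rfl⟩ | ⟨E, -, h⟩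
    · obtain rfl := Symbol.nonterminal.inj h
      obtain ⟨x', hw, run⟩ := Grammar.BlockRun.of_single (Y := Y) (b := b) (c := c ++ x ++ e)
        (w := w) (by simpa [hW] using rest)
      simp at le
      exact ⟨γ', r :: γ, x', x, k, j, by
        simpa using List.perm_append_comm (l₁ := r :: γ), by simp [hw],
        run, .singleton mem pos block, by omega, by omega, by omega, by omega⟩
    · rcases append_singleton_append_eq h with ⟨rfl, h', rfl⟩ | ⟨F, h', -⟩ | ⟨F, -, h'⟩
      · obtain rfl := Symbol.nonterminal.inj h'
        obtain ⟨x', hw, run⟩ := Grammar.BlockRun.of_single (Y := Z) (b := b ++ x ++ c) (c := e)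
          (w := w) (by simpa [hW] using rest)
        simp at le
        exact ⟨r :: γ, γ', x, x', j, k, by simp, by simp [hw], .singleton mem pos block, run,
          by omega, by omega, by omega, by omega⟩
      · exact absurd (by simp [h']) (nonterminal_notMem_tstr r.input b)
      · exact absurd (by simp [h']) (nonterminal_notMem_tstr r.input c)
    · exact absurd (by simp [h]) (nonterminal_notMem_tstr r.input e)

/-! ### Letter-bounded languages -/

/-- For increasing indices, `a_{i₁}* ⋯ a_{iₛ}*` consists of the words spelled by the nondecreasing
sequences of these indices. -/
lemma mem_letterBounded {a : ℕ → T} {I : List ℕ} (hI : I.Pairwise (· < ·)) {w : List T} :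
    w ∈ letterBounded a I ↔ ∃ s : List ℕ, s.Pairwise (· ≤ ·) ∧ (∀ i ∈ s, i ∈ I) ∧ w = s.map a := by
  induction I generalizing w with
  | nil =>
    simp only [letterBounded, List.map_nil, List.prod_nil, Language.mem_one, List.not_mem_nil]
    constructor
    · rintro rfl
      exact ⟨[], by simp⟩
    · rintro ⟨s, -, hs, rfl⟩
      simpa using List.eq_nil_iff_forall_not_mem.2 hs
  | cons i I ih =>
    obtain ⟨hi, hI⟩ := List.pairwise_cons.1 hI
    have hmul : w ∈ letterBounded a (i :: I) ↔
        ∃ n : ℕ, ∃ v ∈ letterBounded a I, List.replicate n (a i) ++ v = w := by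
      simp only [letterBounded, List.map_cons, List.prod_cons, Language.mem_mul]
      constructor
      · rintro ⟨u, hu, v, hv, rfl⟩
        obtain ⟨L, rfl, hL⟩ := Language.mem_kstar.1 hu
        have hL' : L = List.replicate L.length [a i] := List.eq_replicate_iff.2 ⟨rfl, hL⟩
        exact ⟨L.length, v, hv, by rw [hL']; simp⟩
      · rintro ⟨n, v, hv, rfl⟩
        refine ⟨_, Language.mem_kstar.2 ⟨List.replicate n [a i], ?_, ?_⟩, v, hv, rfl⟩
        · simp
        · intro y hy
          exact List.eq_of_mem_replicate hy
    rw [hmul]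
    clear hmul
    constructor
    · rintro ⟨n, v, hv, rfl⟩
      obtain ⟨s, hs, hsI, rfl⟩ := (ih hI).1 hv
      refine ⟨List.replicate n i ++ s, List.pairwise_append.2 ⟨?_, hs, ?_⟩, ?_, by simp⟩
      · simp [List.pairwise_replicate]
      · intro j hj j' hj'
        rw [List.eq_of_mem_replicate hj]
        exact (hi j' (hsI j' hj')).le
      · intro j hj
        rcases List.mem_append.1 hj with hj | hj
        · simp [List.eq_of_mem_replicate hj]
        · simp [hsI j hj]
    · rintro ⟨s, hs, hsI, rfl⟩
      induction s with
      | nil => exact ⟨0, [], (ih hI).2 ⟨[], by simp⟩, by simp⟩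
      | cons j s ihs =>
        obtain ⟨hj, hs'⟩ := List.pairwise_cons.1 hs
        rcases List.mem_cons.1 (hsI j (by simp)) with rfl | hjI
        · obtain ⟨n, v, hv, h⟩ := ihs hs' (fun i h => hsI i (by simp [h]))
          exact ⟨n + 1, v, hv, by simp [List.replicate_succ, h]⟩
        · refine ⟨0, _, (ih hI).2 ⟨j :: s, hs, ?_, rfl⟩, by simp⟩
          intro i' hi'
          rcases List.mem_cons.1 hi' with rfl | hi'
          · exact hjI
          · rcases List.mem_cons.1 (hsI i' (by simp [hi'])) with rfl | h
            · exact absurd (hj _ hi') (by have := hi j hjI; omega)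
            · exact h

lemma mem_segment {a : ℕ → T} {l m : ℕ} (hlm : l ≤ m) {w : List T} :
    w ∈ segment a l m ↔
      ∃ s : List ℕ, s.Pairwise (· ≤ ·) ∧ (∀ i ∈ s, l ≤ i ∧ i ≤ m) ∧ w = s.map a := by
  rw [segment, mem_letterBounded (List.pairwise_lt_range' 1)]
  have (i : ℕ) : i ∈ List.range' l (m + 1 - l) ↔ l ≤ i ∧ i ≤ m := by
    rw [List.mem_range'_1]; omega
  simp only [this]

lemma mem_segment_of_sublist {a : ℕ → T} {l m : ℕ} (hlm : l ≤ m) {u w : List T} (huw : u.Sublist w)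
    (hw : w ∈ segment a l m) : u ∈ segment a l m := by
  obtain ⟨s, hs, hs', rfl⟩ := (mem_segment hlm).1 hw
  obtain ⟨t, ht, rfl⟩ := List.sublist_map_iff.1 huw
  exact (mem_segment hlm).2 ⟨t, hs.sublist ht, fun i hi => hs' i (ht.subset hi), rfl⟩

section Letters

variable {a : ℕ → T} {d : ℕ}

lemma index_le_of_append_mem_segment (ha : Set.InjOn a (Set.Icc 1 d)) (hd : 1 ≤ d) {u v : List T}
    (h : u ++ v ∈ segment a 1 d) {i j : ℕ} (hi : i ∈ Set.Icc 1 d) (hj : j ∈ Set.Icc 1 d)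
    (hu : a i ∈ u) (hv : a j ∈ v) : i ≤ j := by
  obtain ⟨s, hs, hs', h⟩ := (mem_segment hd).1 h
  obtain ⟨su, sv, rfl, rfl, rfl⟩ := List.map_eq_append_iff.1 h.symm
  obtain ⟨i', hi', h₁⟩ := List.mem_map.1 hu
  obtain ⟨j', hj', h₂⟩ := List.mem_map.1 hv
  obtain rfl := ha (hs' i' (by simp [hi'])) hi h₁
  obtain rfl := ha (hs' j' (by simp [hj'])) hj h₂
  exact (List.pairwise_append.1 hs).2.2 _ hi' _ hj'

lemma exists_index_of_mem_segment (hd : 1 ≤ d) {w : List T} (h : w ∈ segment a 1 d) {c : T}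
    (hc : c ∈ w) : ∃ i ∈ Set.Icc 1 d, a i = c := by
  obtain ⟨s, hs, hs', rfl⟩ := (mem_segment hd).1 h
  obtain ⟨i, hi, rfl⟩ := List.mem_map.1 hc
  exact ⟨i, hs' i hi, rfl⟩

/-- Only letters `a 1` precede an occurrence of `a 1`. -/
lemma eq_of_mem_of_append_mem_segment (ha : Set.InjOn a (Set.Icc 1 d)) (hd : 1 ≤ d) {u v : List T}
    (h : u ++ a 1 :: v ∈ segment a 1 d) : ∀ c ∈ u, c = a 1 := by
  intro c hc
  obtain ⟨i, hi, rfl⟩ := exists_index_of_mem_segment hd h (c := c) (by simp [hc])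
  have := index_le_of_append_mem_segment ha hd h hi (j := 1) ⟨le_rfl, hd⟩ hc (by simp)
  rw [le_antisymm this hi.1]

/-- Only letters `a d` follow an occurrence of `a d`. -/
lemma eq_of_mem_of_append_mem_segment' (ha : Set.InjOn a (Set.Icc 1 d)) (hd : 1 ≤ d) {u v : List T}
    (h : u ++ [a d] ++ v ∈ segment a 1 d) : ∀ c ∈ v, c = a d := by
  intro c hc
  obtain ⟨i, hi, rfl⟩ := exists_index_of_mem_segment hd h (c := c) (by simp [hc])
  have := index_le_of_append_mem_segment ha hd h (i := d) ⟨hd, le_rfl⟩ hi (by simp) hc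
  rw [le_antisymm this hi.2]

/-- A word of `a_1* ⋯ a_d*` containing `a 1` starts with it. -/
lemma exists_cons_of_mem_segment (ha : Set.InjOn a (Set.Icc 1 d)) (hd : 1 ≤ d) {w : List T}
    (h : w ∈ segment a 1 d) (h₁ : a 1 ∈ w) : ∃ v, w = a 1 :: v := by
  obtain ⟨u, v, rfl⟩ := List.append_of_mem h₁
  have := eq_of_mem_of_append_mem_segment ha hd h
  cases u with
  | nil => exact ⟨v, rfl⟩
  | cons c u => exact ⟨u ++ a 1 :: v, by simp [this c (by simp)]⟩

/-- A word of `a_1* ⋯ a_d*` containing `a d` ends with it. -/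
lemma exists_concat_of_mem_segment (ha : Set.InjOn a (Set.Icc 1 d)) (hd : 1 ≤ d) {w : List T}
    (h : w ∈ segment a 1 d) (h₁ : a d ∈ w) : ∃ v, w = v ++ [a d] := by
  obtain ⟨u, v, rfl⟩ := List.append_of_mem h₁
  have := eq_of_mem_of_append_mem_segment' ha hd (u := u) (v := v) (by simpa using h)
  rcases List.eq_nil_or_concat v with rfl | ⟨v, c, rfl⟩
  · exact ⟨u, by simp⟩
  · exact ⟨u ++ a d :: v, by simp [this c (by simp)]⟩

/-- By minimality of `a_1* ⋯ a_d*`, every one of its letters occurs in `L`. -/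
lemma IsMinimalFor.exists_mem {L : Language T} (hd : 1 ≤ d) (h : IsMinimalFor a d L) {i : ℕ}
    (hi : i ∈ Set.Icc 1 d) : ∃ w ∈ L, w ∈ segment a 1 d ∧ a i ∈ w := by
  obtain ⟨w, hw, hw'⟩ := Set.not_subset.1 (h.2 i hi)
  refine ⟨w, hw, h.1 hw, ?_⟩
  obtain ⟨s, hs, hs', rfl⟩ := (mem_segment hd).1 (h.1 hw)
  by_contra hiw
  refine hw' ((mem_letterBounded ?_).2 ⟨s, hs, fun j hj => ?_, rfl⟩)
  · exact (List.pairwise_lt_range' 1).sublist List.erase_sublist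
  · refine (List.mem_erase_of_ne ?_).2 (List.mem_range'_1.2 (by have := hs' j hj; omega))
    rintro rfl
    exact hiw (List.mem_map_of_mem hj)

/-- The choice of the cut point: if all indices of `I` are at most those of `J`, and neither set
contains both `1` and `d`, there is `m` between `I` and `J` such that neither of the two ranges of
indices is all of `1, …, d`. -/
lemma exists_cut (hd : 3 ≤ d) {I J : Set ℕ} (hI : I ⊆ Set.Icc 1 d) (hJ : J ⊆ Set.Icc 1 d)
    (hIJ : ∀ i ∈ I, ∀ j ∈ J, i ≤ j) (hI' : ¬ (1 ∈ I ∧ d ∈ I)) (hJ' : ¬ (1 ∈ J ∧ d ∈ J)) :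
    ∃ l m r : ℕ, 1 ≤ l ∧ l ≤ m ∧ m ≤ r ∧ r ≤ d ∧ max (m - l) (r - m) < d - 1 ∧
      I ⊆ Set.Icc l m ∧ J ⊆ Set.Icc m r := by
  have ne_of_mem {K : Set ℕ} {i j : ℕ} (hj : j ∉ K) (hi : i ∈ K) : i ≠ j := fun h => hj (h ▸ hi)
  by_cases hdI : d ∈ I
  · have h1 : 1 ∉ I := fun h => hI' ⟨h, hdI⟩
    refine ⟨2, d, d, by omega, by omega, le_rfl, le_rfl, by omega, fun i hi => ?_, fun j hj => ?_⟩
    · have := hI hi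
      have := ne_of_mem h1 hi
      simp only [Set.mem_Icc] at *
      omega
    · exact ⟨hIJ d hdI j hj, (hJ hj).2⟩
  by_cases h1J : 1 ∈ J
  · have hdJ : d ∉ J := fun h => hJ' ⟨h1J, h⟩
    refine ⟨1, 1, d - 1, le_rfl, le_rfl, by omega, by omega, by omega, fun i hi => ?_,
      fun j hj => ?_⟩
    · exact ⟨(hI hi).1, hIJ i hi 1 h1J⟩
    · have := hJ hj
      have := ne_of_mem hdJ hj
      simp only [Set.mem_Icc] at *
      omega
  -- `m` is the largest element of `I`, replaced by `2` if this is smaller.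
  have hfin : (insert 2 I).Finite := ((Set.finite_Icc 1 d).subset hI).insert 2
  obtain ⟨m, hm, hmax⟩ := hfin.exists_maximal ⟨2, by simp⟩
  have hle : ∀ i ∈ insert 2 I, i ≤ m := fun i hi => (le_total i m).elim id fun h => hmax hi h
  have h2 : 2 ≤ m := hle 2 (by simp)
  have hmd : m < d := by
    rcases hm with rfl | hm
    · omega
    · have := hI hm
      have := ne_of_mem hdI hm
      simp only [Set.mem_Icc] at *
      omega
  refine ⟨1, m, d, le_rfl, by omega, by omega, le_rfl, by omega, fun i hi => ?_, fun j hj => ?_⟩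
  · exact ⟨(hI hi).1, hle i (by simp [hi])⟩
  · refine ⟨?_, (hJ hj).2⟩
    rcases hm with rfl | hm
    · have := hJ hj
      have := ne_of_mem h1J hj
      simp only [Set.mem_Icc] at *
      omega
    · exact hIJ m hm j hj

/-- The cut for two languages whose product lies in `a_1* ⋯ a_d*`, when neither of them has both a
word starting with `a 1` and a word ending with `a d`. -/
lemma exists_segments (ha : Set.InjOn a (Set.Icc 1 d)) (hd : 3 ≤ d) {K L : Language T}
    (hK : ∃ u, u ∈ K) (hL : ∃ v, v ∈ L) (hKL : ∀ u ∈ K, ∀ v ∈ L, u ++ v ∈ segment a 1 d)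
    (hK' : ¬ ((∃ w, a 1 :: w ∈ K) ∧ ∃ w, w ++ [a d] ∈ K))
    (hL' : ¬ ((∃ w, a 1 :: w ∈ L) ∧ ∃ w, w ++ [a d] ∈ L)) :
    ∃ l m r : ℕ, 1 ≤ l ∧ l ≤ m ∧ m ≤ r ∧ r ≤ d ∧ max (m - l) (r - m) < d - 1 ∧
      K ≤ segment a l m ∧ L ≤ segment a m r := by
  have hd1 : 1 ≤ d := by omega
  obtain ⟨u₀, hu₀⟩ := hK
  obtain ⟨v₀, hv₀⟩ := hL
  have hKd : ∀ u ∈ K, u ∈ segment a 1 d := fun u hu =>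
    mem_segment_of_sublist hd1 (List.sublist_append_left u v₀) (hKL u hu v₀ hv₀)
  have hLd : ∀ v ∈ L, v ∈ segment a 1 d := fun v hv =>
    mem_segment_of_sublist hd1 (List.sublist_append_right u₀ v) (hKL u₀ hu₀ v hv)
  have not_both {M : Language T} (hM : ∀ u ∈ M, u ∈ segment a 1 d)
      (hM' : ¬ ((∃ w, a 1 :: w ∈ M) ∧ ∃ w, w ++ [a d] ∈ M)) :
      ¬ ((∃ u ∈ M, a 1 ∈ u) ∧ ∃ u ∈ M, a d ∈ u) := by
    rintro ⟨⟨u, hu, h1⟩, v, hv, hdv⟩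
    obtain ⟨u', rfl⟩ := exists_cons_of_mem_segment ha hd1 (hM u hu) h1
    obtain ⟨v', rfl⟩ := exists_concat_of_mem_segment ha hd1 (hM v hv) hdv
    exact hM' ⟨⟨u', hu⟩, v', hv⟩
  have le_segment {M : Language T} {l m : ℕ} (hlm : l ≤ m) (hM : ∀ u ∈ M, u ∈ segment a 1 d)
      (h : {i | i ∈ Set.Icc 1 d ∧ ∃ u ∈ M, a i ∈ u} ⊆ Set.Icc l m) : M ≤ segment a l m := by
    intro u hu
    obtain ⟨s, hs, hs', rfl⟩ := (mem_segment hd1).1 (hM u hu)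
    exact (mem_segment hlm).2
      ⟨s, hs, fun i hi => h ⟨hs' i hi, _, hu, List.mem_map_of_mem hi⟩, rfl⟩
  obtain ⟨l, m, r, hl, hlm, hmr, hr, hmax, hI, hJ⟩ := exists_cut hd
    (I := {i | i ∈ Set.Icc 1 d ∧ ∃ u ∈ K, a i ∈ u}) (J := {i | i ∈ Set.Icc 1 d ∧ ∃ u ∈ L, a i ∈ u})
    (fun i hi => hi.1) (fun i hi => hi.1)
    (fun i ⟨hi, u, hu, hiu⟩ j ⟨hj, v, hv, hjv⟩ =>
      index_le_of_append_mem_segment ha hd1 (hKL u hu v hv) hi hj hiu hjv)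
    (fun h => not_both hKd hK' ⟨h.1.2, h.2.2⟩) (fun h => not_both hLd hL' ⟨h.1.2, h.2.2⟩)
  exact ⟨l, m, r, hl, hlm, hmr, hr, hmax, le_segment hlm hKd hI, le_segment hmr hLd hJ⟩

end Letters

/-! ### Derivations in context -/

lemma Grammar.Derives.mono {G' : Grammar T N} {U V : List (Symbol T N)} (h : G.Derives U V)
    (hG : G.prods ⊆ G'.prods) : G'.Derives U V := by
  induction h with
  | refl => exact .refl
  | tail _ hstep ih =>
    obtain ⟨r, hr, h⟩ := hstep
    exact ih.tail ⟨r, hG hr, h⟩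

lemma Grammar.Derives.trans {U V W : List (Symbol T N)} (h : G.Derives U V)
    (h' : G.Derives V W) : G.Derives U W :=
  Relation.ReflTransGen.trans h h'

lemma Grammar.Derives.of_mem {r : ContextFreeRule T N} (hr : r ∈ G.prods) :
    G.Derives [Symbol.nonterminal r.input] r.output :=
  Relation.ReflTransGen.single ⟨r, hr, .input_output⟩

lemma Grammar.Derives.append {U V : List (Symbol T N)} (h : G.Derives U V)
    (P S : List (Symbol T N)) : G.Derives (P ++ U ++ S) (P ++ V ++ S) := by
  induction h with
  | refl => exact .refl
  | tail _ hstep ih =>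
    obtain ⟨r, hr, h⟩ := hstep
    exact ih.tail ⟨r, hr, (h.append_left P).append_right S⟩

lemma Grammar.Derives.append_append {U V U' V' : List (Symbol T N)} (h : G.Derives U V)
    (h' : G.Derives U' V') : G.Derives (U ++ U') (V ++ V') := by
  have h₁ := h.append [] U'
  have h₂ := h'.append V []
  simp only [List.nil_append, List.append_nil] at h₁ h₂
  exact h₁.trans h₂

/-- A derivation from a product of words splits into derivations from its factors. -/
lemma Grammar.Derives.split {U W : List (Symbol T N)} (h : G.Derives U W) :
    ∀ {A B : List (Symbol T N)}, U = A ++ B →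
      ∃ A' B', W = A' ++ B' ∧ G.Derives A A' ∧ G.Derives B B' := by
  induction h using Relation.ReflTransGen.head_induction_on with
  | refl => exact fun h => ⟨_, _, h, .refl, .refl⟩
  | head hstep _ ih =>
    rintro A B rfl
    obtain ⟨r, hr, hrw⟩ := hstep
    obtain ⟨P, S, h, rfl⟩ := hrw.exists_parts
    rcases append_eq_append_singleton_append h with ⟨E, rfl, rfl⟩ | ⟨E, rfl, rfl⟩
    · obtain ⟨A', B', hW, hA, hB⟩ := ih (A := P ++ r.output ++ E) (B := B) (by simp)
      exact ⟨A', B', hW, ((Grammar.Derives.of_mem hr).append P E).trans hA, hB⟩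
    · obtain ⟨A', B', hW, hA, hB⟩ := ih (A := A) (B := E ++ r.output ++ S) (by simp)
      exact ⟨A', B', hW, hA, ((Grammar.Derives.of_mem hr).append E S).trans hB⟩

lemma Grammar.BlockRun.derives {k : ℕ} {U W : List (Symbol T N)}
    {γ : List (ContextFreeRule T N)} (h : G.BlockRun k U γ W) : G.Derives U W := by
  induction h with
  | nil => exact .refl
  | @cons k j r P S W x γ γ' mem pos le block rest ih₁ ih₂ =>
    exact (((Grammar.Derives.of_mem mem).trans ih₁).append P S).trans ih₂

lemma mem_lang {X : N} {w : List T} :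
    w ∈ G.lang X ↔ G.Derives [Symbol.nonterminal X] (tstr w) := by
  constructor
  · rintro ⟨u, v, rfl, h⟩
    simpa [ntWord] using h
  · intro h
    exact ⟨w, [], by simp, by simpa [ntWord] using h⟩

/-- `G.Reaches X Y`: some `u Y v` with terminal words `u` and `v` is derivable from `X`. -/
def Grammar.Reaches (G : Grammar T N) (X Y : N) : Prop :=
  ∃ u v : List T, G.Derives [Symbol.nonterminal X] (tstr u ++ [Symbol.nonterminal Y] ++ tstr v)

lemma Grammar.Reaches.refl (X : N) : G.Reaches X X := ⟨[], [], .refl⟩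

lemma Grammar.Reaches.trans {X Y Z : N} (h : G.Reaches X Y) (h' : G.Reaches Y Z) :
    G.Reaches X Z := by
  obtain ⟨u, v, h⟩ := h
  obtain ⟨u', v', h'⟩ := h'
  exact ⟨u ++ u', v' ++ v, by simpa using h.trans (h'.append (tstr u) (tstr v))⟩

/-- The sides of a nonterminal occurring in a word that derives a terminal word derive terminal
words themselves. -/
lemma Grammar.Derives.split_tstr {A B M : List (Symbol T N)} {w : List T}
    (h : G.Derives (A ++ M ++ B) (tstr w)) :
    ∃ u x v, w = u ++ x ++ v ∧ G.Derives A (tstr u) ∧ G.Derives M (tstr x) ∧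
      G.Derives B (tstr v) := by
  obtain ⟨C, V, hw, hC, hV⟩ := h.split rfl
  obtain ⟨y, v, rfl, rfl, rfl⟩ := tstr_eq_append hw
  obtain ⟨U, X, hw, hU, hX⟩ := hC.split rfl
  obtain ⟨u, x, rfl, rfl, rfl⟩ := tstr_eq_append hw
  exact ⟨u, x, v, rfl, hU, hX, hV⟩

lemma Grammar.Reaches.of_mem_output {r : ContextFreeRule T N} (hr : r ∈ G.prods) {w : List T}
    (hw : G.Derives r.output (tstr w)) {Z : N} (hZ : Symbol.nonterminal Z ∈ r.output) :
    G.Reaches r.input Z := by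
  obtain ⟨A, B, hAB⟩ := List.append_of_mem hZ
  replace hAB : r.output = A ++ [Symbol.nonterminal Z] ++ B := by simpa using hAB
  rw [hAB] at hw
  obtain ⟨u, x, v, -, hA, -, hB⟩ := hw.split_tstr
  have := Grammar.Derives.of_mem hr
  rw [hAB] at this
  exact ⟨u, v, this.trans ((hA.append_append .refl).append_append hB)⟩

/-! ### Nonterminals generating words that start with the first and end with the last letter -/

section Hat

variable {a : ℕ → T} {d : ℕ} {X : N}

/-- What surrounds a nonterminal of `hat` in a word derived from `X`. -/
lemma letters_around_hat (ha : Set.InjOn a (Set.Icc 1 d)) (hd : 1 ≤ d)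
    (hX : G.lang X ≤ segment a 1 d) {Y : N} (hY : Y ∈ G.hat (a 1) (a d)) {u v : List T}
    (h : G.Derives [Symbol.nonterminal X] (tstr u ++ [Symbol.nonterminal Y] ++ tstr v)) :
    (∀ c ∈ u, c = a 1) ∧ ∀ c ∈ v, c = a d := by
  obtain ⟨⟨w, hw⟩, w', hw'⟩ := hY
  have mem {x : List T} (hx : x ∈ G.lang Y) : u ++ x ++ v ∈ segment a 1 d :=
    hX (mem_lang.2 (by simpa using h.trans ((mem_lang.1 hx).append (tstr u) (tstr v))))
  constructor
  · exact eq_of_mem_of_append_mem_segment ha hd (v := w ++ v) (by simpa using mem hw)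
  · exact eq_of_mem_of_append_mem_segment' ha hd (u := u ++ w') (by simpa using mem hw')

/-- A nonterminal between `X` and a nonterminal of `hat` lies in `hat`: around the latter only
letters `a 1` on the left and `a d` on the right can be added. -/
lemma mem_hat_of_reaches (ha : Set.InjOn a (Set.Icc 1 d)) (hd : 1 ≤ d)
    (hX : G.lang X ≤ segment a 1 d) {Y Z : N} (hXY : G.Reaches X Y) (hYZ : G.Reaches Y Z)
    (hZ : Z ∈ G.hat (a 1) (a d)) : Y ∈ G.hat (a 1) (a d) := by
  obtain ⟨u, v, h⟩ := hXY
  obtain ⟨u', v', h'⟩ := hYZ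
  obtain ⟨hu, hv⟩ := letters_around_hat ha hd hX hZ (u := u ++ u') (v := v' ++ v)
    (by simpa using h.trans (h'.append (tstr u) (tstr v)))
  obtain ⟨⟨w, hw⟩, w', hw'⟩ := hZ
  have mem {x : List T} (hx : x ∈ G.lang Z) : u' ++ x ++ v' ∈ G.lang Y :=
    mem_lang.2 (by simpa using h'.trans ((mem_lang.1 hx).append (tstr u') (tstr v')))
  constructor
  · rcases u' with _ | ⟨c, u'⟩
    · exact ⟨w ++ v', by simpa using mem hw⟩
    · obtain rfl := hu c (by simp)
      exact ⟨u' ++ a 1 :: w ++ v', by simpa using mem hw⟩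
  · rcases List.eq_nil_or_concat v' with rfl | ⟨v', c, rfl⟩
    · exact ⟨u' ++ w', by simpa using mem hw'⟩
    · obtain rfl := hv c (by simp)
      exact ⟨u' ++ w' ++ [a d] ++ v', by simpa using mem hw'⟩

/-- A useful right-hand side contains at most one nonterminal of `hat`: with two of them, an `a d`
could be generated to the left of an `a 1`. -/
lemma not_two_hats (ha : Set.InjOn a (Set.Icc 1 d)) (hd : 2 ≤ d) (hX : G.lang X ≤ segment a 1 d)
    {r : ContextFreeRule T N} (hr : r ∈ G.prods) (hXr : G.Reaches X r.input) {w : List T}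
    (hw : G.Derives r.output (tstr w)) {A M B : List (Symbol T N)} {Y Z : N}
    (h : r.output = A ++ [Symbol.nonterminal Y] ++ M ++ [Symbol.nonterminal Z] ++ B)
    (hY : Y ∈ G.hat (a 1) (a d)) (hZ : Z ∈ G.hat (a 1) (a d)) : False := by
  obtain ⟨u, v, hXr⟩ := hXr
  obtain ⟨y, hy, hdy⟩ : ∃ y ∈ G.lang Y, a d ∈ y :=
    let ⟨y, hy⟩ := hY.2
    ⟨_, hy, by simp⟩
  rw [h] at hw
  obtain ⟨x, -, x₅, -, hx, -, hB⟩ := hw.split_tstr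
  obtain ⟨x₁, -, x₃, rfl, hA, -, hM⟩ := hx.split_tstr
  have hr' := Grammar.Derives.of_mem hr
  rw [h] at hr'
  have hAM := (hA.append_append (mem_lang.1 hy)).append_append hM
  have := (hr'.trans ((hAM.append_append .refl).append_append hB)).append (tstr u) (tstr v)
  have had := (letters_around_hat ha (by omega) hX hZ (u := u ++ x₁ ++ y ++ x₃)
    (v := x₅ ++ v) (by simpa using hXr.trans this)).1 (a d) (by simp [hdy])
  have := ha (by simp; omega) (by simp; omega) had
  omega

/-- A run from useful nonterminals outside `hat` uses only productions with head outside `hat`. -/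
lemma Grammar.BlockRun.input_mem_check (ha : Set.InjOn a (Set.Icc 1 d)) (hd : 1 ≤ d)
    (hX : G.lang X ≤ segment a 1 d) {k : ℕ} {U W : List (Symbol T N)} {w : List T}
    {γ : List (ContextFreeRule T N)} (h : G.BlockRun k U γ W) (hW : W = tstr w)
    (hU : ∀ Y, Symbol.nonterminal Y ∈ U → Y ∈ G.check (a 1) (a d) ∧ G.Reaches X Y) :
    ∀ r ∈ γ, r.input ∈ G.check (a 1) (a d) := by
  induction h generalizing w with
  | nil => simp
  | @cons k j r P S W x γ γ' mem pos le block rest ih₁ ih₂ =>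
    obtain ⟨hr, hXr⟩ := hU r.input (by simp)
    intro s hs
    simp only [List.mem_cons, List.mem_append] at hs
    rcases hs with rfl | hs | hs
    · exact hr
    · refine ih₁ rfl (fun Z hZ => ?_) s hs
      have hrZ := Grammar.Reaches.of_mem_output mem block.derives hZ
      exact ⟨fun hZ' => hr (mem_hat_of_reaches ha hd hX hXr hrZ hZ'), hXr.trans hrZ⟩
    · refine ih₂ hW (fun Z hZ => hU Z ?_) s hs
      simp only [List.mem_append, nonterminal_notMem_tstr, or_false] at hZ
      rcases hZ with hZ | hZ <;> simp [hZ]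

/-- By minimality, `X` itself lies in `hat`. -/
lemma IsMinimalFor.mem_hat (ha : Set.InjOn a (Set.Icc 1 d)) (hd : 1 ≤ d)
    (h : IsMinimalFor a d (G.lang X)) : X ∈ G.hat (a 1) (a d) := by
  constructor
  · obtain ⟨w, hw, hw', h1⟩ := h.exists_mem hd ⟨le_rfl, hd⟩
    obtain ⟨v, rfl⟩ := exists_cons_of_mem_segment ha hd hw' h1
    exact ⟨v, hw⟩
  · obtain ⟨w, hw, hw', h1⟩ := h.exists_mem hd ⟨hd, le_rfl⟩
    obtain ⟨v, rfl⟩ := exists_concat_of_mem_segment ha hd hw' h1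
    exact ⟨v, hw⟩

end Hat

/-! ### The spine of a derivation -/

/-- `G.SpineRun k Y γ u Z v`: a depth-first `k`-index step sequence from `Y` to `u Z v` with control
word `γ`, which can be carried out with arbitrary dates and inside an arbitrary context without
nonterminals. -/
def Grammar.SpineRun (G : Grammar T N) (k : ℕ) (Y : N) (γ : List (ContextFreeRule T N))
    (u : List T) (Z : N) (v : List T) : Prop :=
  ∀ {m t : ℕ} {P S : List (Symbol T N × ℕ)}, (∀ Y' t', (Symbol.nonterminal Y', t') ∉ P ++ S) →
    t ≤ m → ∃ t' ≤ m + γ.length, ∃ P' S', P'.map Prod.fst = tstr u ∧ S'.map Prod.fst = tstr v ∧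
      G.DatedRun k m (P ++ [(Symbol.nonterminal Y, t)] ++ S) γ
        (P ++ P' ++ [(Symbol.nonterminal Z, t')] ++ (S' ++ S))

lemma numNonterminals_map_fst_eq_zero {P : List (Symbol T N × ℕ)}
    (hP : ∀ Y t, (Symbol.nonterminal Y, t) ∉ P) : numNonterminals (P.map Prod.fst) = 0 := by
  rcases exists_tstr_or_nonterminal_mem (P.map Prod.fst) with ⟨u, h⟩ | ⟨Y, h⟩
  · simp [h]
  · obtain ⟨t, ht⟩ := exists_mem_of_map_fst rfl h
    exact absurd ht (hP Y t)

lemma Grammar.SpineRun.refl (k : ℕ) (Y : N) : G.SpineRun k Y [] [] Y [] := fun {m t P S} _ htm =>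
  ⟨t, by simpa using htm, [], [], rfl, rfl, by simpa using .nil _ _⟩

lemma Grammar.SpineRun.step {k : ℕ} {r : ContextFreeRule T N} (hr : r ∈ G.prods) {H Z : N}
    {γ γ' : List (ContextFreeRule T N)} {u v u' v' : List T}
    (h : G.BlockRun k r.output γ (tstr u ++ [Symbol.nonterminal H] ++ tstr v))
    (h' : G.SpineRun k H γ' u' Z v') (hk : 1 ≤ k) :
    G.SpineRun k r.input (r :: γ ++ γ') (u ++ u') Z (v' ++ v) := by
  intro m t P S hPS htm
  have hP0 := numNonterminals_map_fst_eq_zero hPS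
  have hout := h.numNonterminals_le
  obtain ⟨E, hE, hEt, run⟩ := h.exists_datedRun (k := k) (m := m + 1) (t := m + 1) (P := P)
    (S := S) (D := r.output.map (fun s => (s, m + 1))) (by simp [Function.comp_def])
    (by simp +contextual) (fun Y t' h => absurd h (hPS Y t')) le_rfl (by omega)
  obtain ⟨E', S₁, rfl, hE', hS₁⟩ := List.map_eq_append_iff.1 hE
  obtain ⟨P₁, E₀, rfl, hP₁, hE₀⟩ := List.map_eq_append_iff.1 hE'
  obtain ⟨⟨s, t₁⟩, rfl, hs : s = _⟩ := List.map_eq_singleton_iff.1 hE₀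
  subst hs
  obtain rfl : t₁ = m + 1 := hEt H t₁ (by simp)
  obtain ⟨t', ht', P', S', hP', hS', run'⟩ := h' (m := m + 1 + γ.length) (t := m + 1)
    (P := P ++ P₁) (S := S₁ ++ S) (by
      intro Y t' h
      simp only [List.mem_append] at h
      rcases h with (h | h) | (h | h)
      · exact hPS Y t' (by simp [h])
      · exact notMem_of_map_fst_eq_tstr hP₁ Y t' h
      · exact notMem_of_map_fst_eq_tstr hS₁ Y t' h
      · exact hPS Y t' (by simp [h])) (by omega)
  refine ⟨t', by simp; omega, P₁ ++ P', S' ++ S₁, by simp [hP₁, hP'], by simp [hS₁, hS'], ?_⟩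
  refine .cons hr rfl (fun Y t' h => absurd h (hPS Y t')) ?_ ?_ (.trans run ?_)
  · simp at hP0 ⊢
    omega
  · simp [Function.comp_def] at hP0 ⊢
    omega
  · simpa using run'

lemma Grammar.SpineRun.dfDerives {k : ℕ} {Y Z : N} {γ : List (ContextFreeRule T N)} {u v : List T}
    (h : G.SpineRun k Y γ u Z v) :
    G.DFDerives k [Symbol.nonterminal Y] γ (tstr u ++ [Symbol.nonterminal Z] ++ tstr v) := by
  obtain ⟨t', -, P', S', hP', hS', run⟩ := h (m := 0) (t := 0) (P := []) (S := []) (by simp) le_rfl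
  exact ⟨P' ++ [(Symbol.nonterminal Z, t')] ++ S', by simp [hP', hS'], by simpa using run⟩

/-- A spine is continued by a run from its last nonterminal, the only one left. -/
lemma Grammar.SpineRun.dfDerives_append {k : ℕ} {Y Z : N} {γ γ' : List (ContextFreeRule T N)}
    {u v w : List T} (h : G.SpineRun k Y γ u Z v)
    (h' : G.BlockRun k [Symbol.nonterminal Z] γ' (tstr w)) :
    G.DFDerives k [Symbol.nonterminal Y] (γ ++ γ') (tstr (u ++ w ++ v)) := by
  obtain ⟨t', ht', P', S', hP', hS', run⟩ := h (m := 0) (t := 0) (P := []) (S := []) (by simp)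
    le_rfl
  obtain ⟨E, hE, -, run'⟩ := h'.exists_datedRun (k := k) (m := 0 + γ.length) (t := t') (P := P')
    (S := S') (D := [(Symbol.nonterminal Z, t')]) rfl (by simp)
    (by
      intro Y' t₀ h
      rcases List.mem_append.1 h with h | h
      · exact absurd h (notMem_of_map_fst_eq_tstr hP' Y' t₀)
      · exact absurd h (notMem_of_map_fst_eq_tstr hS' Y' t₀))
    ht' (by simp [hP', hS'])
  exact ⟨P' ++ E ++ S', by simp [hP', hE, hS'], .trans (by simpa using run) run'⟩

/-- Going down from `Y` through the nonterminals of `hat`, one reaches a production `p` whose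
right-hand side contains none of them. The subtrees left aside on the way are rewritten before the
path is continued, so that besides them only the next nonterminal of the path is waiting; this
accounts for the index `k + 1`. -/
lemma Grammar.BlockRun.exists_spine {a : ℕ → T} {d : ℕ} {X : N} (ha : Set.InjOn a (Set.Icc 1 d))
    (hd : 2 ≤ d) (hX : G.lang X ≤ segment a 1 d) {k : ℕ} :
    ∀ (n : ℕ) {Y : N} {γ : List (ContextFreeRule T N)} {w : List T}, γ.length ≤ n →
      Y ∈ G.hat (a 1) (a d) → G.Reaches X Y → G.BlockRun k [Symbol.nonterminal Y] γ (tstr w) →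
      ∃ p ∈ G.prods, ∃ γs γ₁ u v x, p.input ∈ G.hat (a 1) (a d) ∧ G.Reaches X p.input ∧
        (∀ Z, Symbol.nonterminal Z ∈ p.output → Z ∈ G.check (a 1) (a d)) ∧
        G.BlockRun k p.output γ₁ (tstr x) ∧ (∀ r ∈ γ₁, r.input ∈ G.check (a 1) (a d)) ∧
        (∀ r ∈ γs, r ∈ (G.sharp (a 1) (a d)).prods) ∧ (γs ++ [p] ++ γ₁).Perm γ ∧
        w = u ++ x ++ v ∧ G.SpineRun (k + 1) Y γs u p.input v := by
  intro n
  have hd1 : 1 ≤ d := by omega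
  induction n with
  | zero => ?_
  | succ n ih => ?_
  all_goals
    intro Y γ w hn hY hXY run
    obtain ⟨r, hr, rfl, γ, rfl, block⟩ := run.of_nonterminal
  · simp at hn
  by_cases hout : ∀ Z, Symbol.nonterminal Z ∈ r.output → Z ∈ G.check (a 1) (a d)
  · refine ⟨r, hr, [], γ, [], [], w, hY, hXY, hout, block, ?_, by simp, by simp, by simp,
      Grammar.SpineRun.refl _ _⟩
    exact block.input_mem_check ha hd1 hX rfl fun Z hZ =>
      ⟨hout Z hZ, hXY.trans (.of_mem_output hr block.derives hZ)⟩
  · push Not at hout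
    obtain ⟨H, hHr, hH⟩ := hout
    replace hH : H ∈ G.hat (a 1) (a d) := not_not.1 hH
    have hXH := hXY.trans (.of_mem_output hr block.derives hHr)
    obtain ⟨A, B, hAB⟩ := List.append_of_mem hHr
    replace hAB : r.output = A ++ [Symbol.nonterminal H] ++ B := by simpa using hAB
    obtain ⟨γ', γH, u, x, v, hperm, rfl, runH, hM⟩ := block.extract hAB rfl
    obtain ⟨p, hp, γs, γ₁, u', v', x, hpY, hXp, hpout, run₁, hγ₁, hγs, hperm', rfl, hspine⟩ :=
      ih (by have := hperm.length_eq; simp at hn this; omega) hH hXH runH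
    have rest : G.BlockRun k (A ++ B) γ' (tstr (u ++ v)) := by simpa using hM []
    -- There is no room for a second nonterminal of `hat` beside `H`.
    have hcheck : ∀ Z, Symbol.nonterminal Z ∈ A ++ B →
        Z ∈ G.check (a 1) (a d) ∧ G.Reaches X Z := by
      intro Z hZ
      refine ⟨fun hZ' => ?_, hXY.trans (.of_mem_output hr block.derives ?_)⟩
      · rcases List.mem_append.1 hZ with hZ | hZ
        · obtain ⟨A₁, A₂, rfl⟩ := List.append_of_mem hZ
          exact not_two_hats ha hd hX hr hXY block.derives (A := A₁) (M := A₂) (B := B)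
            (by simpa using hAB) hZ' hH
        · obtain ⟨B₁, B₂, rfl⟩ := List.append_of_mem hZ
          exact not_two_hats ha hd hX hr hXY block.derives (A := A) (M := B₁) (B := B₂)
            (by simpa using hAB) hH hZ'
      · rw [hAB]
        rcases List.mem_append.1 hZ with hZ | hZ <;> simp [hZ]
    have hγ' := rest.input_mem_check ha hd1 hX rfl hcheck
    refine ⟨p, hp, r :: γ' ++ γs, γ₁, u ++ u', v' ++ v, x, hpY, hXp, hpout, run₁, hγ₁, ?_, ?_,
      by simp, Grammar.SpineRun.step hr ?_ hspine (by omega)⟩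
    · intro s hs
      simp only [List.cons_append, List.mem_cons, List.mem_append] at hs
      rcases hs with rfl | hs | hs
      · exact Or.inr ⟨hr, hY, H, hH, A, B, hAB⟩
      · exact Or.inl ⟨rest.mem_prods s hs, hγ' s hs⟩
      · exact hγs s hs
    · have := (hperm'.append_left γ').trans hperm.symm
      simpa using this
    · rw [hAB]
      simpa using hM [Symbol.nonterminal H]

/-- A complete run from `b y c z` consists of runs from `y` and from `z`. If one of the two is
missing, its empty run may be given any index. -/
lemma Grammar.BlockRun.of_aybz {k : ℕ} (hk : 0 < k) {b c : Option T} {y z : Option N} {w : List T}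
    {γ : List (ContextFreeRule T N)} (h : G.BlockRun k (aybz b y c z) γ (tstr w)) :
    ∃ γy γz uy uz ky kz, γ.Perm (γy ++ γz) ∧ w = b.toList ++ uy ++ c.toList ++ uz ∧
      G.BlockRun ky (ntWord y) γy (tstr uy) ∧ G.BlockRun kz (ntWord z) γz (tstr uz) ∧
      max ky kz ≤ k ∧ min ky kz ≤ k - 1 ∧ (2 ≤ k → 0 < ky ∧ 0 < kz) := by
  simp only [aybz, tWord_eq_tstr] at h
  have nil (l : ℕ) : G.BlockRun l (ntWord none) [] (tstr []) := .nil (by simp [ntWord])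
  rcases y with _ | Y <;> rcases z with _ | Z
  · obtain ⟨rfl, hw⟩ := Grammar.BlockRun.of_tstr (u := b.toList ++ c.toList)
      (by simpa [ntWord] using h)
    exact ⟨[], [], [], [], k - 1, k, by simp, by simpa using tstr_inj.1 hw, nil _, nil _,
      by omega, by omega, by omega⟩
  · obtain ⟨x, hw, run⟩ := Grammar.BlockRun.of_single (Y := Z) (b := b.toList ++ c.toList)
      (c := []) (k := k) (γ := γ) (w := w) (by simpa [ntWord] using h)
    exact ⟨[], γ, [], x, k - 1, k, by simp, by simpa using hw, nil _, run,
      by omega, by omega, by omega⟩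
  · obtain ⟨x, hw, run⟩ := Grammar.BlockRun.of_single (Y := Y) (b := b.toList) (c := c.toList)
      (k := k) (γ := γ) (w := w) (by simpa [ntWord] using h)
    exact ⟨γ, [], x, [], k, k - 1, by simp, by simpa using hw, run, nil _,
      by omega, by omega, by omega⟩
  · obtain ⟨γy, γz, uy, uz, ky, kz, hperm, hw, runy, runz, hky, hkz, hmax, hmin⟩ :=
      Grammar.BlockRun.of_pair (Y := Y) (Z := Z) (b := b.toList) (c := c.toList) (e := [])
        (k := k) (γ := γ) (w := w) (by simpa [ntWord] using h)
    exact ⟨γy, γz, uy, uz, ky, kz, hperm, by simpa using hw, runy, runz, hmax, hmin,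
      fun _ => ⟨hky, hkz⟩⟩

/-! ### The languages of the spine and of the two branches -/

lemma Grammar.Derives.of_nil {U : List (Symbol T N)} (h : G.Derives [] U) : U = [] := by
  rcases Relation.ReflTransGen.cases_head h with h | ⟨V, ⟨r, -, hr⟩, -⟩
  · exact h.symm
  · exact absurd hr.nonterminal_input_mem (by simp)

lemma Grammar.langTo_mono {G' : Grammar T N} (hG : G.prods ⊆ G'.prods) {X : N} {Y : Option N} :
    G.langTo X Y ≤ G'.langTo X Y := by
  rintro w ⟨u, v, rfl, h⟩
  exact ⟨u, v, rfl, h.mono hG⟩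

lemma langTo_le_letterBounded {a : ℕ → T} {d : ℕ} {X Y : N} (ha : Set.InjOn a (Set.Icc 1 d))
    (hd : 2 ≤ d) (hX : G.lang X ≤ segment a 1 d) (hY : Y ∈ G.hat (a 1) (a d)) :
    G.langTo X (some Y) ≤ letterBounded a [1, d] := by
  rintro _ ⟨u, v, rfl, h⟩
  obtain ⟨hu, hv⟩ := letters_around_hat ha (by omega) hX hY h
  refine (mem_letterBounded (by simp; omega)).2
    ⟨List.replicate u.length 1 ++ List.replicate v.length d, ?_, ?_, ?_⟩
  · simp [List.pairwise_append, List.pairwise_replicate]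
    omega
  · intro i hi
    rcases List.mem_append.1 hi with hi | hi <;> simp [List.eq_of_mem_replicate hi]
  · simpa using congrArg₂ (· ++ ·) (List.eq_replicate_of_mem hu) (List.eq_replicate_of_mem hv)

/-- The two branches below the spine generate words over complementary segments of the letters,
and neither segment is everything because the branches lie outside `hat`. -/
lemma exists_segments_of_aybz {a : ℕ → T} {d : ℕ} {X : N} (ha : Set.InjOn a (Set.Icc 1 d))
    (hd : 3 ≤ d) (hX : G.lang X ≤ segment a 1 d) {p : ContextFreeRule T N} (hp : p ∈ G.prods)
    (hXp : G.Reaches X p.input) {b c : Option T} {y z : Option N} (hout : p.output = aybz b y c z)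
    (hy : ∀ Y : N, y = some Y → Y ∈ G.check (a 1) (a d))
    (hz : ∀ Z : N, z = some Z → Z ∈ G.check (a 1) (a d))
    (huy : ∃ u : List T, G.Derives (ntWord y) (tstr u))
    (huz : ∃ u : List T, G.Derives (ntWord z) (tstr u)) :
    ∃ l m r : ℕ, 1 ≤ l ∧ l ≤ m ∧ m ≤ r ∧ r ≤ d ∧ max (m - l) (r - m) < d - 1 ∧
      (∀ Y : N, y = some Y → G.lang Y ≤ segment a l m) ∧
      (∀ Z : N, z = some Z → G.lang Z ≤ segment a m r) := by
  -- If `y` or `z` is missing, its language consists of the empty word.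
  let K (y : Option N) : Language T := {x | G.Derives (ntWord y) (tstr x)}
  have not_both (y : Option N) (hy : ∀ Y : N, y = some Y → Y ∈ G.check (a 1) (a d)) :
      ¬ ((∃ w, a 1 :: w ∈ K y) ∧ ∃ w, w ++ [a d] ∈ K y) := by
    rintro ⟨⟨w₁, h₁⟩, w₂, h₂⟩
    rcases y with _ | Y
    · have := Grammar.Derives.of_nil h₁
      simp [tstr] at this
    · exact hy Y rfl ⟨⟨w₁, mem_lang.2 h₁⟩, w₂, mem_lang.2 h₂⟩
  have hKL : ∀ x ∈ K y, ∀ x' ∈ K z, x ++ x' ∈ segment a 1 d := by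
    intro x hx x' hx'
    obtain ⟨u, v, hXp⟩ := hXp
    have hpx : G.Derives p.output (tstr (b.toList ++ x ++ c.toList ++ x')) := by
      have h₁ := Grammar.Derives.append hx (tstr b.toList) (tstr c.toList ++ ntWord z)
      have h₂ := Grammar.Derives.append hx' (tstr (b.toList ++ x ++ c.toList)) []
      rw [hout]
      simpa [aybz, tWord_eq_tstr] using h₁.trans (by simpa using h₂)
    have hder : G.Derives [Symbol.nonterminal X]
        (tstr (u ++ (b.toList ++ x ++ c.toList ++ x') ++ v)) := by
      simpa using hXp.trans (((Grammar.Derives.of_mem hp).trans hpx).append (tstr u) (tstr v))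
    refine mem_segment_of_sublist (by omega) ?_ (hX (mem_lang.2 hder))
    refine .trans ?_ (List.sublist_append_left _ v)
    refine .trans ?_ (List.sublist_append_right u _)
    refine .append ?_ (.refl x')
    exact (List.sublist_append_right _ x).trans (List.sublist_append_left _ _)
  obtain ⟨l, m, r, hl, hlm, hmr, hr, hlmr, hyl, hzl⟩ := exists_segments ha hd
    (K := K y) (L := K z) huy huz hKL (not_both y hy) (not_both z hz)
  refine ⟨l, m, r, hl, hlm, hmr, hr, hlmr, ?_, ?_⟩
  · rintro Y rfl w hw
    exact hyl (mem_lang.1 hw)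
  · rintro Z rfl w hw
    exact hzl (mem_lang.1 hw)

end IndexedCFG

open IndexedCFG in
theorem mainTheorem3 {T N : Type*} [Finite T] [Finite N] (G : IndexedCFG.Grammar T N)
    (hG : G.IsGeneralForm) (X : N) (d : ℕ) (hd : 3 ≤ d)
    (a : ℕ → T) (ha : Set.InjOn a (Set.Icc 1 d))
    (hmin : IndexedCFG.IsMinimalFor a d (G.lang X))
    (hpivot : G.PivotsAreAybz (a 1) (a d))
    (k : ℕ) (hk : 0 < k) (γ : List (ContextFreeRule T N)) (w : List T)
    (hγ : G.DFDerives k [Symbol.nonterminal X] γ (IndexedCFG.tstr w)) :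
    ∃ (p : ContextFreeRule T N) (b c : Option T) (y z : Option N)
      (γs γy γz : List (ContextFreeRule T N)),
      p ∈ G.prods ∧ p.output = IndexedCFG.aybz b y c z ∧
      p.input ∈ G.hat (a 1) (a d) ∧
      (∀ Y : N, y = some Y → Y ∈ G.check (a 1) (a d)) ∧
      (∀ Z : N, z = some Z → Z ∈ G.check (a 1) (a d)) ∧
      (∀ r ∈ γs, r ∈ (G.sharp (a 1) (a d)).prods) ∧
      (∀ r ∈ γy, r ∈ (G.pivot (a 1) (a d) p).prods) ∧
      (∀ r ∈ γz, r ∈ (G.pivot (a 1) (a d) p).prods) ∧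
      (γs ++ [p] ++ γy ++ γz).Perm γ ∧
      -- the prefix
      (∃ u v : List T, (G.sharp (a 1) (a d)).DFDerives (k + 1) [Symbol.nonterminal X] γs
        (IndexedCFG.tstr u ++ [Symbol.nonterminal p.input] ++ IndexedCFG.tstr v)) ∧
      -- the derivations from `y` and `z`, and how they are put together
      (∃ uy uz : List T,
        (∃ ky kz : ℕ,
          (G.pivot (a 1) (a d) p).DFDerives ky (IndexedCFG.ntWord y) γy (IndexedCFG.tstr uy) ∧
          (G.pivot (a 1) (a d) p).DFDerives kz (IndexedCFG.ntWord z) γz (IndexedCFG.tstr uz) ∧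
          max ky kz ≤ k ∧ min ky kz ≤ k - 1 ∧ (2 ≤ k → 0 < ky ∧ 0 < kz)) ∧
        ((G.pivot (a 1) (a d) p).DFDerives (k - 1) (IndexedCFG.ntWord y) γy
            (IndexedCFG.tstr uy) →
          G.DFDerives (k + 1) [Symbol.nonterminal X] (γs ++ [p] ++ γy ++ γz)
            (IndexedCFG.tstr w)) ∧
        ((G.pivot (a 1) (a d) p).DFDerives (k - 1) (IndexedCFG.ntWord z) γz
            (IndexedCFG.tstr uz) →
          G.DFDerives (k + 1) [Symbol.nonterminal X] (γs ++ [p] ++ γz ++ γy)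
            (IndexedCFG.tstr w))) ∧
      -- the languages
      (G.sharp (a 1) (a d)).langTo X (some p.input) ≤ IndexedCFG.letterBounded a [1, d] ∧
      (∃ l m r : ℕ, 1 ≤ l ∧ l ≤ m ∧ m ≤ r ∧ r ≤ d ∧ max (m - l) (r - m) < d - 1 ∧
        (∀ Y : N, y = some Y →
          (G.pivot (a 1) (a d) p).lang Y ≤ IndexedCFG.segment a l m) ∧
        (∀ Z : N, z = some Z →
          (G.pivot (a 1) (a d) p).lang Z ≤ IndexedCFG.segment a m r)) := by
  have hd1 : 1 ≤ d := by omega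
  have hX := hmin.1
  have hXhat := hmin.mem_hat ha hd1
  obtain ⟨p, hp, γs, γ₁, u, v, x, hphat, hXp, hpout, run₁, hγ₁, hγs, hperm, rfl, hspine⟩ :=
    hγ.blockRun.exists_spine ha (by omega) hX γ.length le_rfl hXhat (.refl X)
  obtain ⟨b, c, y, z, hout⟩ := hpivot p hp hphat hpout
  have hy : ∀ Y : N, y = some Y → Y ∈ G.check (a 1) (a d) := by
    rintro Y rfl
    exact hpout Y (by simp [hout, aybz, ntWord])
  have hz : ∀ Z : N, z = some Z → Z ∈ G.check (a 1) (a d) := by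
    rintro Z rfl
    exact hpout Z (by simp [hout, aybz, ntWord])
  rw [hout] at run₁
  obtain ⟨γy, γz, uy, uz, ky, kz, hperm₁, rfl, runy, runz, hmax, hminyz, hpos⟩ := run₁.of_aybz hk
  have hpiv : ∀ r ∈ γy ++ γz, r ∈ (G.pivot (a 1) (a d) p).prods := by
    intro r hr
    refine Or.inl ⟨?_, hγ₁ r (hperm₁.mem_iff.2 hr)⟩
    rcases List.mem_append.1 hr with hr | hr
    exacts [runy.mem_prods r hr, runz.mem_prods r hr]
  have hγy : ∀ r ∈ γy, r ∈ (G.pivot (a 1) (a d) p).prods := fun r hr => hpiv r (by simp [hr])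
  have hγz : ∀ r ∈ γz, r ∈ (G.pivot (a 1) (a d) p).prods := fun r hr => hpiv r (by simp [hr])
  have hny := numNonterminals_ntWord_le (T := T) y
  have hnz := numNonterminals_ntWord_le (T := T) z
  -- With `k + 1` at hand, `y` and `z` can be rewritten in either order.
  have join (δ : List (ContextFreeRule T N))
      (h : G.BlockRun (k + 1) p.output δ (tstr (b.toList ++ uy ++ c.toList ++ uz))) :
      G.DFDerives (k + 1) [Symbol.nonterminal X] (γs ++ [p] ++ δ)
        (tstr (u ++ (b.toList ++ uy ++ c.toList ++ uz) ++ v)) := by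
    have := hspine.dfDerives_append (.singleton hp (by omega) h)
    simpa using this
  have frame {k' : ℕ} {U W : List (Symbol T N)} {δ : List (ContextFreeRule T N)}
      (h : G.BlockRun k' U δ W) (hk' : k' ≤ k) (P S : List (Symbol T N))
      (hPS : numNonterminals (P ++ S) ≤ 1) :
      G.BlockRun (k + 1) (P ++ U ++ S) δ (P ++ W ++ S) := h.append P S (by omega)
  refine ⟨p, b, c, y, z, γs, γy, γz, hp, hout, hphat, hy, hz, hγs, hγy, hγz, ?_,
    ⟨u, v, hspine.dfDerives.mono hγs⟩, ⟨uy, uz, ⟨ky, kz, runy.dfDerives.mono hγy,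
      runz.dfDerives.mono hγz, hmax, hminyz, hpos⟩, fun _ => ?_, fun _ => ?_⟩, ?_, ?_⟩
  · have := (hperm₁.symm.append_left (γs ++ [p])).trans hperm
    simpa using this
  · have h₁ := frame runy (by omega) (tstr b.toList) (tstr c.toList ++ ntWord z) (by simpa using hnz)
    have h₂ := frame runz (by omega) (tstr (b.toList ++ uy ++ c.toList)) [] (by simp)
    have := join (γy ++ γz) (by
      rw [hout]
      simpa [aybz, tWord_eq_tstr] using h₁.trans (by simpa using h₂))
    simpa using this
  · have h₁ := frame runz (by omega) (tstr b.toList ++ ntWord y ++ tstr c.toList) []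
      (by simpa using hny)
    have h₂ := frame runy (by omega) (tstr b.toList) (tstr (c.toList ++ uz)) (by simp)
    have := join (γz ++ γy) (by
      rw [hout]
      simpa [aybz, tWord_eq_tstr] using h₁.trans (by simpa using h₂))
    simpa using this
  · exact (Grammar.langTo_mono (by rintro r (hr | hr) <;> exact hr.1)).trans
      (langTo_le_letterBounded ha (by omega) hX hphat)
  · have hpivG : (G.pivot (a 1) (a d) p).prods ⊆ G.prods := by
      rintro r (hr | rfl)
      exacts [hr.1, hp]
    obtain ⟨l, m, r, hl, hlm, hmr, hr, hlmr, hyl, hzl⟩ := exists_segments_of_aybz ha hd hX hp hXp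
      hout hy hz ⟨uy, runy.derives⟩ ⟨uz, runz.derives⟩
    exact ⟨l, m, r, hl, hlm, hmr, hr, hlmr, fun Y h => (Grammar.langTo_mono hpivG).trans (hyl Y h),
      fun Z h => (Grammar.langTo_mono hpivG).trans (hzl Z h)⟩
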